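/- Let $q\ge 2$ be a prime power, let $c,d$ be integers with $d\ge c\ge 3$, let $l_0\ge 1$ be an integer and let $\alpha\in(0,1-1/q)$. For $n\ge 1$ with $d\mid cn$, the random $(c,d)$-regular LDPC code $\mathcal{C}^{(n)}_{q,c,d}$ over the field $\mathbb{F}_q$ is the kernel of the random linear map $\mathbb{F}_q^n\to\mathbb{F}_q^{cn/d}$ that repeats every coordinate of $x\in\mathbb{F}_q^n$ consecutively $c$ times, which gives a vector of $\mathbb{F}_q^{cn}$, permutes the coordinates of this vector by a uniformly random permutation $\Pi$ of $\{1,\dots,cn\}$, multiplies the $j$-th coordinate by a uniformly random $C_j\in\mathbb{F}_q\setminus\{0\}$ for $j=1,\dots,cn$, and sums each of the $cn/d$ blocks of $d$ consecutive coordinates; here $\Pi,C_1,\dots,C_{cn}$ are independent. The minimum distance $d_{\min}(C)$ of a code $C\subseteq\mathbb{F}_q^n$ is the minimum Hamming distance of two distinct codewords ($+\infty$ if $|C|\le 1$). Define $$\omega_{q,c,d}(x)=H_q(x)+\frac{c}{d}\bigl[\delta_{q,d}(x)-\ln q\bigr],\qquad \delta_{q,d}(x)=\inf_{y\in(0,1)}\bigl[d\,D(x\|y)+\rho_{q,d}(y)\bigr],$$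 where $$H_q(x)=x\ln\tfrac1x+(1-x)\ln\tfrac1{1-x}+x\ln(q-1),\qquad D(x\|y)=x\ln\tfrac xy+(1-x)\ln\tfrac{1-x}{1-y},$$ $$\rho_{q,d}(y)=\ln\Bigl[1+(q-1)\Bigl(1-\frac{qy}{q-1}\Bigr)^d\Bigr].$$ Let $\Delta=1$ if $q=2$ and $cl_0$ is odd, and $\Delta=0$ otherwise. Write $f(n)=\Theta(g(n))$ if there are constants $c_1,c_2>0$ with $c_1g(n)\le f(n)\le c_2g(n)$ for all sufficiently large $n$. Then $$P\bigl\{l_0\le d_{\min}(\mathcal{C}^{(n)}_{q,c,d})\le n\alpha\bigr\}\le\Theta\bigl(n^{-\lceil(c-2)(l_0+\Delta)/2\rceil}\bigr)+\Theta\bigl(n^{3/2}e^{n\omega_{q,c,d}(\alpha)}\bigr),$$ that is, there are functions $A(n)=\Theta(n^{-\lceil(c-2)(l_0+\Delta)/2\rceil})$ and $B(n)=\Theta(n^{3/2}e^{n\omega_{q,c,d}(\alpha)})$, depending on $q,c,d,l_0,\alpha$, such that the probability is at most $A(n)+B(n)$ for every $n\ge1$ with $d\mid cn$. -/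

import Mathlib

open Filter

namespace LDPC

noncomputable section

/-! ### The random regular LDPC code -/

section Code

variable (F : Type*) [Field F]

/-- The `n`-fold product of the single symbol repetition `x ↦ (x, …, x)` (`c` times):
`(x_0, …, x_{n-1}) ↦ (x_0, …, x_0, x_1, …, x_1, …)`, where every symbol is repeated `c` times. -/
def repetition (c n : ℕ) : (Fin n → F) →ₗ[F] (Fin (c * n) → F) :=
  LinearMap.funLeft F F fun j : Fin (c * n) => ⟨j / c, Nat.div_lt_of_lt_mul j.isLt⟩

/-- The interleaver `x ↦ (x_{π⁻¹(1)}, …, x_{π⁻¹(N)})` of a permutation `π`. -/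
def interleaver {N : ℕ} (π : Equiv.Perm (Fin N)) : (Fin N → F) →ₗ[F] (Fin N → F) :=
  LinearMap.funLeft F F π.symm

/-- The coordinatewise multiplication `(x_j) ↦ (a_j x_j)` by nonzero field elements `a_j`. -/
def multiplier {N : ℕ} (a : Fin N → Fˣ) : (Fin N → F) →ₗ[F] (Fin N → F) :=
  LinearMap.pi fun j => (a j : F) • LinearMap.proj j

/-- For `d ∣ N`, the `(N / d)`-fold product of the single symbol check
`(y_0, …, y_{d-1}) ↦ y_0 + ⋯ + y_{d-1}`: the `i`-th output is the sum of the `i`-th block of `d`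
consecutive coordinates of the input. -/
def check (d N : ℕ) : (Fin N → F) →ₗ[F] (Fin (N / d) → F) :=
  LinearMap.pi fun i => ∑ k : Fin d, LinearMap.proj (R := F) (φ := fun _ : Fin N => F)
    (⟨d * i + k, by
      have h1 : d * ((i : ℕ) + 1) ≤ d * (N / d) := Nat.mul_le_mul_left d i.isLt
      have h2 : d * (N / d) ≤ N := Nat.mul_div_le N d
      have h3 : (k : ℕ) < d := k.isLt
      rw [Nat.mul_add, Nat.mul_one] at h1
      omega⟩ : Fin N)

/-- The linear map `F^n → F^{cn/d}` obtained by repetition, interleaving with `π`, multiplication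
by the `a_j`, and check. -/
def ldpcMap (c d n : ℕ) (π : Equiv.Perm (Fin (c * n))) (a : Fin (c * n) → Fˣ) :
    (Fin n → F) →ₗ[F] (Fin (c * n / d) → F) :=
  check F d (c * n) ∘ₗ multiplier F a ∘ₗ interleaver F π ∘ₗ repetition F c n

/-- The law of the random `(c, d)`-regular LDPC code of length `n` over `F` (for `d ∣ c * n`): the
law of the kernel of `ldpcMap`, where the permutation is uniform over the symmetric group on `c * n`
letters, the `c * n` multipliers are uniform over `Fˣ`, and all of them are independent, that is,
where the pair of the permutation and the vector of multipliers is uniform. -/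
def randomCode [Fintype F] [DecidableEq F] (c d n : ℕ) : PMF (Submodule F (Fin n → F)) :=
  (PMF.uniformOfFintype (Equiv.Perm (Fin (c * n)) × (Fin (c * n) → Fˣ))).map
    fun ω => LinearMap.ker (ldpcMap F c d n ω.1 ω.2)

variable {F}

/-- The minimum Hamming distance of two distinct codewords of a code; it is `⊤` for a code with at
most one codeword. -/
def minDist [DecidableEq F] {n : ℕ} (C : Set (Fin n → F)) : ℕ∞ :=
  ⨅ (u ∈ C) (v ∈ C) (_ : u ≠ v), (hammingDist u v : ℕ∞)

end Code

/-! ### The growth rate of the average weight distribution -/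

/-- The information divergence `D(x‖y) = x ln (x / y) + (1 - x) ln ((1 - x) / (1 - y))`. -/
def divergence (x y : ℝ) : ℝ :=
  x * Real.log (x / y) + (1 - x) * Real.log ((1 - x) / (1 - y))

/-- `ρ_{q,d}(x) = ln [1 + (q - 1) (1 - q x / (q - 1)) ^ d]`. -/
def rho (q d : ℕ) (x : ℝ) : ℝ :=
  Real.log (1 + ((q : ℝ) - 1) * (1 - q * x / ((q : ℝ) - 1)) ^ d)

/-- `δ_{q,d}(x)` is the infimum of `d D(x‖y) + ρ_{q,d}(y)` over `y ∈ (0, 1)`. For `d ≥ 2` the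
infimum is over a set that is bounded below at least for all `x ∈ (0, 1 - 1 / q)`. -/
def delta (q d : ℕ) (x : ℝ) : ℝ :=
  sInf ((fun y : ℝ => d * divergence x y + rho q d y) '' Set.Ioo 0 1)

/-- `ω_{q,c,d}(x) = H_q(x) + (c / d) (δ_{q,d}(x) - ln q)`, where
`H_q(x) = x ln (1 / x) + (1 - x) ln (1 / (1 - x)) + x ln (q - 1)`. -/
def omega (q c d : ℕ) (x : ℝ) : ℝ :=
  Real.qaryEntropy q x + (c : ℝ) / d * (delta q d x - Real.log q)

/-! ### Asymptotic notation -/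

/-- `f(n) = Θ(g(n))`: there are `c₁, c₂ > 0` with `c₁ g(n) ≤ f(n) ≤ c₂ g(n)` for all large `n`
(without absolute values, unlike `f =Θ[atTop] g`). -/
def BigTheta (f g : ℕ → ℝ) : Prop :=
  ∃ c₁ > 0, ∃ c₂ > 0, ∀ᶠ n in atTop, c₁ * g n ≤ f n ∧ f n ≤ c₂ * g n

end

end LDPC

/-! The proof is a first moment bound. A minimum distance in the given range forces a codeword of
some weight `l` between `l₀` and `nα`, so the probability is at most the sum of the mean weight
counts (`prob_le_sum`). The random monomial map acts transitively on words of fixed weight, hence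
`meanWeight` is the number of words of weight `l` times the fraction of words of weight `cl` that
satisfy all checks.

If ω(α) ≥ 0, the second term of the bound is at least 1 and nothing remains to show. If ω(α) < 0,
the whole sum is O(n^{-κ}) with κ the ceiling in the theorem, so the second term is only needed to
be nonnegative. The weights fall into four ranges.

Weights below `l₀ + Δ` contribute nothing, since binary check words have even weight
(`checkCount_eq_zero`). Each of the finitely many further `l < 2κ` contributes O(n^{-κ}), because a
nonzero block has weight at least 2 and so few blocks are nonzero (`meanWeight_mul_pow_le`). For `2κ
≤ l ≤ εn` the terms are at most n^{-κ} times a summable sequence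
(`meanWeight_mul_pow_le_geometric`).

For `εn < l ≤ αn` a Chernoff bound with the weight enumerator of the parity check code applies
(`meanWeight_le_exp`), and its exponent must be uniformly negative. Parametrised by the optimal
Chernoff parameter, the exponent first falls and then rises, so it is at most the maximum of its
endpoint values (`gibbsExponent_le_max`). At α it is negative by hypothesis
(`exists_chernoffExponent_neg`), at a small ε by an elementary estimate
(`chernoffExponent_sqrt_neg`). -/

namespace LDPC

/-! ### Monomial symmetry and the first moment bound -/

section Random

variable {F : Type*} [Field F] [DecidableEq F]

/-- The monomial map that permutes coordinates by `π` and then multiplies them by `a`. -/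
def monomial {N : ℕ} (π : Equiv.Perm (Fin N)) (a : Fin N → Fˣ) (x : Fin N → F) : Fin N → F :=
  fun j => (a j : F) * x (π.symm j)

theorem ldpcMap_apply (c d n : ℕ) (π : Equiv.Perm (Fin (c * n))) (a : Fin (c * n) → Fˣ)
    (x : Fin n → F) :
    ldpcMap F c d n π a x = check F d (c * n) (monomial π a (repetition F c n x)) := by
  simp only [ldpcMap, LinearMap.comp_apply]
  congr 1

theorem monomial_monomial {N : ℕ} (π σ : Equiv.Perm (Fin N)) (a b : Fin N → Fˣ) (x : Fin N → F) :
    monomial π a (monomial σ b x) = monomial (π * σ) (a * fun j => b (π.symm j)) x := by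
  funext j
  simp [monomial, mul_assoc, Equiv.Perm.mul_def]

theorem hammingNorm_monomial {N : ℕ} (π : Equiv.Perm (Fin N)) (a : Fin N → Fˣ) (x : Fin N → F) :
    hammingNorm (monomial π a x) = hammingNorm x := by
  unfold hammingNorm
  apply Finset.card_nbij' (fun j => π.symm j) (fun j => π j) <;> intro j <;> simp [monomial]

/-- A bijection between the supports extends to a permutation of all coordinates, and the
multipliers then correct the nonzero values. This transitivity is all that is used about the
distribution of the random map. -/
theorem exists_monomial_eq {N : ℕ} {x y : Fin N → F} (h : hammingNorm x = hammingNorm y) :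
    ∃ π a, monomial π a x = y := by
  have hcard : Fintype.card {j // x j ≠ 0} = Fintype.card {j // y j ≠ 0} := by
    rw [Fintype.card_subtype, Fintype.card_subtype]
    exact h
  let e := Fintype.equivOfCardEq hcard
  have key : ∀ j, x (e.extendSubtype.symm j) = 0 ↔ y j = 0 := by
    intro j
    obtain ⟨i, rfl⟩ := e.extendSubtype.surjective j
    rw [Equiv.symm_apply_apply]
    by_cases hi : x i = 0
    · have := e.extendSubtype_not_mem i (by simpa using hi)
      simp only [not_not] at this
      simp [hi, this]
    · have := e.extendSubtype_mem i hi
      simp [hi, this]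
  refine ⟨e.extendSubtype, fun j => if hj : y j ≠ 0 then
    Units.mk0 (y j / x (e.extendSubtype.symm j))
      (div_ne_zero hj fun h => hj ((key j).1 h)) else 1, ?_⟩
  funext j
  by_cases hj : y j = 0
  · simp [monomial, hj, (key j).2 hj]
  · have hx : x (e.extendSubtype.symm j) ≠ 0 := fun h0 => hj ((key j).1 h0)
    simp [monomial, hj, div_mul_cancel₀ _ hx]

variable [Fintype F]

variable (F) in
/-- The vectors of Hamming weight `w`. -/
def weightSphere (N w : ℕ) : Finset (Fin N → F) :=
  Finset.univ.filter fun y => hammingNorm y = w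

theorem mem_weightSphere {N w : ℕ} {y : Fin N → F} : y ∈ weightSphere F N w ↔ hammingNorm y = w := by
  simp [weightSphere]

theorem card_weightSphere (N w : ℕ) :
    (weightSphere F N w).card = N.choose w * (Fintype.card F - 1) ^ w := by
  classical
  rw [Finset.card_eq_sum_card_fiberwise (f := fun y : Fin N → F => Finset.univ.filter (y · ≠ 0))
    (t := Finset.powersetCard w Finset.univ)]
  · rw [Finset.sum_const_nat (m := (Fintype.card F - 1) ^ w), Finset.card_powersetCard,
      Finset.card_univ, Fintype.card_fin]
    intro S hS
    rw [Finset.mem_powersetCard_univ] at hS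
    have : ((weightSphere F N w).filter fun y => Finset.univ.filter (y · ≠ 0) = S) =
        Fintype.piFinset fun i => if i ∈ S then Finset.univ.erase (0 : F) else {0} := by
      ext y
      simp only [Finset.mem_filter, mem_weightSphere, Fintype.mem_piFinset]
      constructor
      · rintro ⟨-, rfl⟩ i
        by_cases hi : y i = 0 <;> simp [hi]
      · intro hy
        have hS' : Finset.univ.filter (y · ≠ 0) = S := by
          ext i
          have := hy i
          by_cases hi : i ∈ S <;> simp_all
        refine ⟨?_, hS'⟩
        unfold hammingNorm
        rw [hS', hS]
    rw [this, Fintype.card_piFinset, ← hS, ← Finset.prod_const]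
    rw [← Finset.prod_subset (Finset.subset_univ S)]
    · refine Finset.prod_congr rfl fun i hi => ?_
      simp [hi, Finset.card_erase_of_mem, Finset.card_univ]
    · intro i _ hi
      simp [hi]
  · intro y hy
    simp only [Finset.mem_coe, mem_weightSphere] at hy
    exact Finset.mem_powersetCard_univ.2 hy

/-- The number of monomial maps that send `x` to a vector with property `p`. -/
def monomialCount {N : ℕ} (p : (Fin N → F) → Prop) [DecidablePred p] (x : Fin N → F) : ℕ :=
  (Finset.univ.filter fun ω : Equiv.Perm (Fin N) × (Fin N → Fˣ) => p (monomial ω.1 ω.2 x)).card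

theorem monomialCount_eq_sum {N : ℕ} (p : (Fin N → F) → Prop) [DecidablePred p] (x : Fin N → F) :
    monomialCount p x = ∑ π : Equiv.Perm (Fin N), ∑ a : Fin N → Fˣ,
      if p (monomial π a x) then 1 else 0 := by
  rw [monomialCount, Finset.card_filter, Fintype.sum_prod_type]

theorem monomialCount_monomial {N : ℕ} (p : (Fin N → F) → Prop) [DecidablePred p]
    (σ : Equiv.Perm (Fin N)) (b : Fin N → Fˣ) (x : Fin N → F) :
    monomialCount p (monomial σ b x) = monomialCount p x := by
  simp only [monomialCount_eq_sum, monomial_monomial]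
  conv_rhs => rw [← Equiv.sum_comp (Equiv.mulRight σ)]
  refine Finset.sum_congr rfl fun π _ => ?_
  conv_rhs => rw [← Equiv.sum_comp (Equiv.mulRight fun j => b (π.symm j))]
  rfl

/-- Double counting of pairs (map, word): by transitivity the count is the same for every word of
the sphere, while each single map permutes the sphere. -/
theorem monomialCount_mul_card {N : ℕ} (p : (Fin N → F) → Prop) [DecidablePred p]
    (x : Fin N → F) :
    monomialCount p x * (weightSphere F N (hammingNorm x)).card =
      Fintype.card (Equiv.Perm (Fin N) × (Fin N → Fˣ)) *
        ((weightSphere F N (hammingNorm x)).filter p).card := by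
  have h1 : ∑ r ∈ weightSphere F N (hammingNorm x), monomialCount p r =
      (weightSphere F N (hammingNorm x)).card * monomialCount p x := by
    rw [Finset.sum_const_nat]
    intro r hr
    obtain ⟨π, a, rfl⟩ := exists_monomial_eq (mem_weightSphere.1 hr).symm
    exact monomialCount_monomial p π a x
  rw [mul_comm, ← h1]
  simp only [monomialCount, Finset.card_filter]
  rw [Finset.sum_comm, Finset.sum_const_nat (m := ((weightSphere F N (hammingNorm x)).filter p).card),
    Finset.card_univ, Finset.card_filter]
  rintro ⟨π, a⟩ -
  rw [← Finset.card_filter]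
  apply Finset.card_nbij' (fun r => monomial π a r)
    (fun y i => ((a (π i))⁻¹ : Fˣ) * y (π i))
  · intro r
    simp [mem_weightSphere, hammingNorm_monomial]
  · intro y hy
    have hy' : monomial π a (fun i => ((a (π i))⁻¹ : Fˣ) * y (π i)) = y := by
      funext j; simp [monomial]
    simp only [Finset.coe_filter, mem_weightSphere, Set.mem_ofPred_eq] at hy ⊢
    rw [hy', ← hammingNorm_monomial π a, hy']
    exact hy
  · intro r _
    funext i; simp [monomial]
  · intro y _
    funext j; simp [monomial]

theorem hammingNorm_repetition {c n : ℕ} (x : Fin n → F) :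
    hammingNorm (repetition F c n x) = c * hammingNorm x := by
  rcases Nat.eq_zero_or_pos c with rfl | hc
  · have : hammingNorm (repetition F 0 n x) ≤ Fintype.card (Fin (0 * n)) :=
      hammingNorm_le_card_fintype
    simpa using this
  unfold hammingNorm
  have hprod : c * (Finset.univ.filter (x · ≠ 0)).card =
      (Finset.univ.filter (x · ≠ 0) ×ˢ (Finset.univ : Finset (Fin c))).card := by
    rw [Finset.card_product, Finset.card_univ, Fintype.card_fin, mul_comm]
  rw [hprod]
  symm
  let e : Fin n × Fin c ≃ Fin (c * n) := finProdFinEquiv.trans (finCongr (Nat.mul_comm n c))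
  have he : ∀ p : Fin n × Fin c, repetition F c n x (e p) = x p.1 := by
    rintro ⟨i, k⟩
    simp only [repetition, LinearMap.funLeft_apply]
    congr 1
    ext
    simp [e, Nat.add_mul_div_left _ _ hc, Nat.div_eq_of_lt k.isLt]
  refine Finset.card_equiv e ?_
  intro p
  simp [he]

variable (F) in
/-- The number of vectors of weight `w` in the kernel of `check`. -/
noncomputable def checkCount (d N w : ℕ) : ℕ :=
  ((weightSphere F N w).filter fun y => check F d N y = 0).card

variable (F) in
/-- The expected number of codewords of weight `l`. -/
noncomputable def meanWeight (c d n l : ℕ) : ℝ :=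
  (n.choose l : ℝ) * ((Fintype.card F : ℝ) - 1) ^ l * checkCount F d (c * n) (c * l) /
    (((c * n).choose (c * l) : ℝ) * ((Fintype.card F : ℝ) - 1) ^ (c * l))

theorem cast_card_weightSphere (N w : ℕ) :
    ((weightSphere F N w).card : ℝ) = (N.choose w : ℝ) * ((Fintype.card F : ℝ) - 1) ^ w := by
  rw [card_weightSphere]
  push_cast [Nat.cast_sub (Fintype.card_pos (α := F))]
  rfl

theorem one_le_card_sub_one : (1 : ℝ) ≤ (Fintype.card F : ℝ) - 1 := by
  have : 2 ≤ Fintype.card F := Fintype.one_lt_card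
  have : (2 : ℝ) ≤ Fintype.card F := by exact_mod_cast this
  linarith

theorem sum_monomialCount {c d n l : ℕ} (hl : l ≤ n) :
    (∑ x ∈ weightSphere F n l,
      (monomialCount (fun y => check F d (c * n) y = 0) (repetition F c n x) : ℝ)) /
      Fintype.card (Equiv.Perm (Fin (c * n)) × (Fin (c * n) → Fˣ)) = meanWeight F c d n l := by
  have ha := one_le_card_sub_one (F := F)
  have hch : (0 : ℝ) < (c * n).choose (c * l) := by
    exact_mod_cast Nat.choose_pos (Nat.mul_le_mul_left c hl)
  have hden : 0 < ((c * n).choose (c * l) : ℝ) * ((Fintype.card F : ℝ) - 1) ^ (c * l) := by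
    positivity
  have hΩ : (0 : ℝ) < Fintype.card (Equiv.Perm (Fin (c * n)) × (Fin (c * n) → Fˣ)) := by
    exact_mod_cast Fintype.card_pos
  rw [Finset.sum_congr rfl (g := fun _ =>
    (Fintype.card (Equiv.Perm (Fin (c * n)) × (Fin (c * n) → Fˣ)) : ℝ) *
      checkCount F d (c * n) (c * l) /
      (((c * n).choose (c * l) : ℝ) * ((Fintype.card F : ℝ) - 1) ^ (c * l)))]
  · rw [Finset.sum_const, nsmul_eq_mul, cast_card_weightSphere, meanWeight]
    field_simp
  · intro x hx
    rw [eq_div_iff hden.ne', ← cast_card_weightSphere, checkCount]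
    have h := monomialCount_mul_card (fun y => check F d (c * n) y = 0) (repetition F c n x)
    rw [hammingNorm_repetition, mem_weightSphere.1 hx] at h
    exact_mod_cast h

theorem exists_weight_of_minDist {n m : ℕ} {C : Submodule F (Fin n → F)}
    (h : minDist (C : Set (Fin n → F)) = (m : ℕ∞)) : ∃ x ∈ C, x ≠ 0 ∧ hammingNorm x = m := by
  -- Comparing with `m + 1` makes the infimum strictly smaller than a number, which produces an
  -- actual pair of codewords.
  have hlt : minDist (C : Set (Fin n → F)) < ((m + 1 : ℕ) : ℕ∞) := by
    rw [h]; exact_mod_cast Nat.lt_succ_self m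
  simp only [minDist, iInf_lt_iff] at hlt
  obtain ⟨u, hu, v, hv, huv, hd⟩ := hlt
  refine ⟨u - v, C.sub_mem hu hv, sub_ne_zero.2 huv, ?_⟩
  rw [sub_eq_neg_add, ← hammingDist_eq_hammingNorm, hammingDist_comm]
  have h1 : hammingDist u v ≤ m := Nat.lt_succ_iff.1 (Nat.cast_lt.1 hd)
  have h2 : (m : ℕ∞) ≤ hammingDist u v := by
    rw [← h]
    exact iInf₂_le_of_le u hu (iInf₂_le_of_le v hv (iInf_le _ huv))
  exact le_antisymm h1 (by exact_mod_cast h2)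

theorem prob_le_one (c d n : ℕ) (s : Set (Submodule F (Fin n → F))) :
    ((randomCode F c d n).toOuterMeasure s).toReal ≤ 1 := by
  refine ENNReal.toReal_le_of_le_ofReal zero_le_one ?_
  rw [ENNReal.ofReal_one, PMF.toOuterMeasure_apply]
  calc _ ≤ ∑' x, (randomCode F c d n) x := ENNReal.tsum_le_tsum fun x => Set.indicator_le_self _ _ _
    _ = 1 := PMF.tsum_coe _

/-- Union bound over all words of each admissible weight. -/
theorem prob_le_sum (c d n l₀ : ℕ) {α : ℝ} (h1 : α ≤ 1) :
    ((randomCode F c d n).toOuterMeasure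
      {C : Submodule F (Fin n → F) | ∃ m : ℕ, minDist (C : Set (Fin n → F)) = (m : ℕ∞) ∧
        l₀ ≤ m ∧ (m : ℝ) ≤ n * α}).toReal ≤
      ∑ l ∈ Finset.Icc l₀ ⌊n * α⌋₊, meanWeight F c d n l := by
  classical
  have hnα : ⌊n * α⌋₊ ≤ n := by
    refine Nat.floor_le_of_le ?_
    nlinarith [Nat.cast_nonneg (α := ℝ) n]
  rw [randomCode, PMF.toOuterMeasure_map_apply, PMF.toOuterMeasure_uniformOfFintype_apply,
    ENNReal.toReal_div, ENNReal.toReal_natCast, ENNReal.toReal_natCast]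
  rw [Finset.sum_congr rfl fun l hl =>
    (sum_monomialCount ((Finset.mem_Icc.1 hl).2.trans hnα)).symm, ← Finset.sum_div]
  gcongr
  rw [← Set.toFinset_card]
  norm_cast
  calc _ ≤ ((Finset.Icc l₀ ⌊n * α⌋₊).biUnion fun l => (weightSphere F n l).biUnion fun x =>
        Finset.univ.filter fun ω : Equiv.Perm (Fin (c * n)) × (Fin (c * n) → Fˣ) =>
          check F d (c * n) (monomial ω.1 ω.2 (repetition F c n x)) = 0).card := by
        refine Finset.card_le_card ?_
        intro ω hω
        simp only [Set.mem_toFinset, Set.mem_preimage, Set.mem_ofPred_eq] at hω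
        obtain ⟨m, hm, hlm, hmα⟩ := hω
        obtain ⟨x, hx, -, hxm⟩ := exists_weight_of_minDist hm
        simp only [Finset.mem_biUnion, Finset.mem_Icc, mem_weightSphere, Finset.mem_filter,
          Finset.mem_univ, true_and]
        refine ⟨m, ⟨hlm, Nat.le_floor hmα⟩, x, hxm, ?_⟩
        rw [← ldpcMap_apply]
        exact hx
    _ ≤ _ := Finset.card_biUnion_le.trans (Finset.sum_le_sum fun l _ => Finset.card_biUnion_le)

end Random

/-! ### Parity check blocks and their weight enumerator -/

section Blocks

variable {F : Type*} [Field F] [Fintype F] [DecidableEq F]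

/-- The decomposition of `N` coordinates into blocks of `d` consecutive ones. -/
def blockEquiv {d N : ℕ} (h : d ∣ N) : Fin (N / d) × Fin d ≃ Fin N :=
  finProdFinEquiv.trans (finCongr (Nat.div_mul_cancel h))

theorem check_apply {d N : ℕ} (h : d ∣ N) (y : Fin N → F) (i : Fin (N / d)) :
    check F d N y i = ∑ k, y (blockEquiv h (i, k)) := by
  simp only [check, LinearMap.pi_apply, LinearMap.sum_apply, LinearMap.proj_apply]
  refine Finset.sum_congr rfl fun k _ => congrArg y (Fin.ext ?_)
  simp [blockEquiv, add_comm]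

theorem hammingNorm_eq_sum_blocks {d N : ℕ} (h : d ∣ N) (y : Fin N → F) :
    hammingNorm y = ∑ i, hammingNorm fun k => y (blockEquiv h (i, k)) := by
  simp only [hammingNorm, Finset.card_filter]
  rw [← Equiv.sum_comp (blockEquiv h), Fintype.sum_prod_type]

variable (F) in
/-- The single parity check code. -/
def singleCheck (d : ℕ) : Finset (Fin d → F) :=
  Finset.univ.filter fun u => ∑ k, u k = 0

theorem block_mem_singleCheck {d N : ℕ} (h : d ∣ N) {y : Fin N → F} (hy : check F d N y = 0)
    (i : Fin (N / d)) : (fun k => y (blockEquiv h (i, k))) ∈ singleCheck F d := by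
  simp only [singleCheck, Finset.mem_filter, Finset.mem_univ, true_and]
  rw [← check_apply h, hy]
  rfl

/-- The kernel of `check` is a product of `N / d` copies of the single parity check code, so sums of
block products factor. -/
theorem sum_prod_blocks {d N : ℕ} (h : d ∣ N) (φ : (Fin d → F) → ℝ) :
    ∑ y ∈ Finset.univ.filter (fun y => check F d N y = 0),
      ∏ i, φ (fun k => y (blockEquiv h (i, k))) = (∑ u ∈ singleCheck F d, φ u) ^ (N / d) := by
  have hpow : (∑ u ∈ singleCheck F d, φ u) ^ (N / d) =
      ∏ _i : Fin (N / d), ∑ u ∈ singleCheck F d, φ u := by simp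
  rw [hpow, Finset.prod_univ_sum]
  refine Finset.sum_equiv
    ((Equiv.arrowCongr (blockEquiv h).symm (Equiv.refl F)).trans (Equiv.curry _ _ _)) ?_ ?_
  · intro y
    simp only [Finset.mem_filter, Finset.mem_univ, true_and, Fintype.mem_piFinset, singleCheck]
    rw [funext_iff]
    refine forall_congr' fun i => ?_
    rw [check_apply h]
    rfl
  · intro y _
    rfl

theorem zero_mem_singleCheck (d : ℕ) : (0 : Fin d → F) ∈ singleCheck F d := by
  simp [singleCheck]

theorem two_le_hammingNorm {d : ℕ} {u : Fin d → F} (hu : u ∈ singleCheck F d) (h0 : u ≠ 0) :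
    2 ≤ hammingNorm u := by
  by_contra! hlt
  have h1 : hammingNorm u = 1 := by
    have := hammingNorm_pos_iff.2 h0
    omega
  obtain ⟨i, hi⟩ := Finset.card_eq_one.1 h1
  have hmem : ∀ j, u j ≠ 0 ↔ j = i := fun j => by
    have := Finset.ext_iff.1 hi j
    simpa using this
  have hsum : ∑ k, u k = u i :=
    Finset.sum_eq_single i (fun j _ hj => by_contra fun h => hj ((hmem j).1 h)) (by simp)
  simp only [singleCheck, Finset.mem_filter, Finset.mem_univ, true_and] at hu
  exact (hmem i).2 rfl (hsum ▸ hu)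

theorem sum_singleCheck_le {d : ℕ} {s : ℝ} (hs : 0 ≤ s) {φ : (Fin d → F) → ℝ} (h0 : φ 0 = 1)
    (h : ∀ u ∈ singleCheck F d, u ≠ 0 → φ u ≤ s) :
    ∑ u ∈ singleCheck F d, φ u ≤ 1 + (Fintype.card F : ℝ) ^ d * s := by
  rw [← Finset.add_sum_erase _ _ (zero_mem_singleCheck d), h0]
  gcongr
  calc _ ≤ ((singleCheck F d).erase 0).card • s :=
        Finset.sum_le_card_nsmul _ _ _ fun u hu =>
          h u (Finset.mem_of_mem_erase hu) (Finset.ne_of_mem_erase hu)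
    _ ≤ _ := by
        rw [nsmul_eq_mul]
        gcongr
        calc (((singleCheck F d).erase 0).card : ℝ) ≤ (Finset.univ : Finset (Fin d → F)).card := by
              exact_mod_cast Finset.card_le_card (Finset.subset_univ _)
          _ = _ := by simp [Finset.card_univ]

variable (F) in
/-- The weight enumerator of the single parity check code. -/
noncomputable def weightEnum (d : ℕ) (z : ℝ) : ℝ := ∑ u ∈ singleCheck F d, z ^ hammingNorm u

theorem one_le_weightEnum (d : ℕ) {z : ℝ} (hz : 0 ≤ z) : 1 ≤ weightEnum F d z := by
  have : z ^ hammingNorm (0 : Fin d → F) ≤ weightEnum F d z :=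
    Finset.single_le_sum (f := fun u : Fin d → F => z ^ hammingNorm u)
      (fun u _ => by positivity) (zero_mem_singleCheck d)
  simpa using this

theorem weightEnum_le (d : ℕ) {z : ℝ} (h0 : 0 ≤ z) (h1 : z ≤ 1) :
    weightEnum F d z ≤ 1 + (Fintype.card F : ℝ) ^ d * z ^ 2 :=
  sum_singleCheck_le (by positivity) (by simp) fun u hu hu0 =>
    pow_le_pow_of_le_one h0 h1 (two_le_hammingNorm hu hu0)

/-- The MacWilliams identity for the parity check code, proved without characters: allowing an
arbitrary value `t` of the sum makes an induction on `d` possible. -/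
theorem sum_hammingNorm_eq (z : ℝ) (d : ℕ) (t : F) :
    (Fintype.card F : ℝ) * (∑ u : Fin d → F, if ∑ k, u k = t then z ^ hammingNorm u else 0) =
      (1 + ((Fintype.card F : ℝ) - 1) * z) ^ d - (1 - z) ^ d +
        if t = 0 then Fintype.card F * (1 - z) ^ d else 0 := by
  induction d generalizing t with
  | zero => by_cases h : t = 0 <;> simp [h, eq_comm, hammingNorm]
  | succ d ih =>
    have hcons : ∀ (r : F) (u : Fin d → F),
        hammingNorm (Fin.cons r u : Fin (d + 1) → F) = (if r = 0 then 0 else 1) + hammingNorm u := by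
      intro r u
      simp only [hammingNorm, Finset.card_filter, Fin.sum_univ_succ, Fin.cons_zero, Fin.cons_succ]
      by_cases hr : r = 0 <;> simp [hr]
    have hstep : (∑ u : Fin (d + 1) → F, if ∑ k, u k = t then z ^ hammingNorm u else 0) =
        ∑ r : F, (if r = 0 then 1 else z) *
          ∑ u : Fin d → F, if ∑ k, u k = t - r then z ^ hammingNorm u else 0 := by
      rw [← Equiv.sum_comp (Fin.consEquiv fun _ => F), Fintype.sum_prod_type]
      refine Finset.sum_congr rfl fun r _ => ?_
      rw [Finset.mul_sum]
      refine Finset.sum_congr rfl fun u _ => ?_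
      rw [show (Fin.consEquiv fun _ => F) (r, u) = (Fin.cons r u : Fin (d + 1) → F) from rfl, hcons,
        pow_add]
      simp only [Fin.sum_univ_succ, Fin.cons_zero, Fin.cons_succ,
        eq_sub_iff_add_eq']
      by_cases hr : r = 0 <;> simp [hr]
    have hsum : ∑ r : F, (if r = 0 then 1 else z) = 1 + ((Fintype.card F : ℝ) - 1) * z := by
      rw [← Finset.add_sum_erase _ _ (Finset.mem_univ (0 : F)), if_pos rfl,
        Finset.sum_congr rfl fun r hr => if_neg (Finset.ne_of_mem_erase hr), Finset.sum_const,
        Finset.card_erase_of_mem (Finset.mem_univ _), Finset.card_univ, nsmul_eq_mul,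
        Nat.cast_sub Fintype.card_pos, Nat.cast_one]
    rw [hstep, Finset.mul_sum]
    simp only [mul_left_comm (Fintype.card F : ℝ), ih]
    simp only [mul_add, Finset.sum_add_distrib, ← Finset.sum_mul, hsum, sub_eq_zero, mul_ite,
      mul_zero]
    rw [Finset.sum_ite_eq Finset.univ t]
    by_cases ht : t = 0 <;> simp [ht] <;> ring

theorem card_mul_weightEnum (d : ℕ) (z : ℝ) :
    (Fintype.card F : ℝ) * weightEnum F d z =
      (1 + ((Fintype.card F : ℝ) - 1) * z) ^ d + ((Fintype.card F : ℝ) - 1) * (1 - z) ^ d := by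
  have := sum_hammingNorm_eq (F := F) z d 0
  rw [weightEnum, singleCheck, Finset.sum_filter, this, if_pos rfl]
  ring

/-- A coefficient of a polynomial with nonnegative coefficients, times the matching power of `z`, is
at most the polynomial's value at `z`. -/
theorem checkCount_le {d N w : ℕ} (h : d ∣ N) {z : ℝ} (hz : 0 < z) :
    (checkCount F d N w : ℝ) * z ^ w ≤ weightEnum F d z ^ (N / d) := by
  rw [weightEnum, ← sum_prod_blocks h]
  simp only [Finset.prod_pow_eq_pow_sum, ← hammingNorm_eq_sum_blocks]
  rw [checkCount, ← nsmul_eq_mul, ← Finset.sum_const]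
  calc _ = ∑ y ∈ (weightSphere F N w).filter (fun y => check F d N y = 0), z ^ hammingNorm y :=
        Finset.sum_congr rfl fun y hy => by
          rw [mem_weightSphere.1 (Finset.mem_of_mem_filter y hy)]
    _ ≤ _ := Finset.sum_le_sum_of_subset_of_nonneg
        (Finset.filter_subset_filter _ (Finset.subset_univ _)) fun y _ _ => by positivity

/-- Here `s` marks nonzero blocks instead of nonzero symbols. Each nonzero block has weight at least
2, so there are at most `w / 2` of them. -/
theorem checkCount_mul_pow_half_le {d N w : ℕ} (h : d ∣ N) {s : ℝ} (hs : 0 < s) (hs1 : s ≤ 1) :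
    (checkCount F d N w : ℝ) * s ^ (w / 2) ≤ (1 + (Fintype.card F : ℝ) ^ d * s) ^ (N / d) := by
  have h1 : (∑ u ∈ singleCheck F d, (s ^ if u = 0 then 0 else 1 : ℝ)) ^ (N / d) ≤
      (1 + (Fintype.card F : ℝ) ^ d * s) ^ (N / d) := by
    refine pow_le_pow_left₀ (Finset.sum_nonneg fun u _ => by positivity) ?_ _
    exact sum_singleCheck_le hs.le (by simp) fun u _ hu0 => by simp [hu0]
  refine le_trans ?_ h1
  rw [← sum_prod_blocks h]
  simp only [Finset.prod_pow_eq_pow_sum]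
  rw [checkCount, ← nsmul_eq_mul, ← Finset.sum_const]
  refine le_trans (Finset.sum_le_sum fun y hy => ?_) (Finset.sum_le_sum_of_subset_of_nonneg
    (Finset.filter_subset_filter _ (Finset.subset_univ (weightSphere F N w)))
      fun y _ _ => by positivity)
  refine pow_le_pow_of_le_one hs.le hs1 ?_
  rw [Finset.mem_filter, mem_weightSphere, hammingNorm_eq_sum_blocks h] at hy
  rw [Nat.le_div_iff_mul_le two_pos, ← hy.1, Finset.sum_mul]
  refine Finset.sum_le_sum fun i _ => ?_
  split_ifs with h0
  · simp
  · simpa using two_le_hammingNorm (block_mem_singleCheck h hy.2 i) h0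

theorem checkCount_eq_zero {d N w : ℕ} (h : d ∣ N) (hF : Fintype.card F = 2) (hw : Odd w) :
    checkCount F d N w = 0 := by
  rw [checkCount, Finset.card_eq_zero, Finset.filter_eq_empty_iff]
  intro y hy hker
  rw [mem_weightSphere, hammingNorm_eq_sum_blocks h] at hy
  refine Nat.not_even_iff_odd.2 hw (hy ▸ Finset.even_sum _ fun i _ => ?_)
  have hu := block_mem_singleCheck h hker i
  generalize (fun k => y (blockEquiv h (i, k))) = u at hu ⊢
  have h2 : (2 : F) = 0 := by
    have := FiniteField.cast_card_eq_zero F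
    rwa [hF] at this
  -- Over the field with two elements every nonzero entry is 1, so the sum is the weight modulo 2.
  have hcast : (hammingNorm u : F) = ∑ k, u k := by
    rw [hammingNorm, Finset.card_filter]
    push_cast
    refine Finset.sum_congr rfl fun k _ => ?_
    by_cases hk : u k = 0
    · simp [hk]
    · have := FiniteField.pow_card_sub_one_eq_one (u k) hk
      rw [hF] at this
      simpa [hk] using this.symm
  by_contra hodd
  obtain ⟨j, hj⟩ := Nat.not_even_iff_odd.1 hodd
  simp only [singleCheck, Finset.mem_filter, Finset.mem_univ, true_and] at hu
  rw [hu, hj] at hcast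
  push_cast at hcast
  rw [h2] at hcast
  simp at hcast

end Blocks

/-! ### Single sign change of the slope -/

noncomputable section Analysis

open Real

/-- By concavity, chords of the logarithm starting at 1 get steeper to the left. -/
theorem neg_log_one_sub_div_le {r s : ℝ} (hr : 0 < r) (hrs : r ≤ s) (hs : s < 1) :
    -log (1 - r) / r ≤ -log (1 - s) / s := by
  have hs0 : 0 < s := hr.trans_le hrs
  have h := strictConcaveOn_log_Ioi.concaveOn.2 (Set.mem_Ioi.2 one_pos)
    (Set.mem_Ioi.2 (sub_pos.2 hs))
    (show 0 ≤ 1 - r / s by rw [sub_nonneg, div_le_one hs0]; exact hrs)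
    (show 0 ≤ r / s by positivity) (by ring)
  simp only [smul_eq_mul, log_one, mul_zero, zero_add] at h
  have he : (1 - r / s) * 1 + r / s * (1 - s) = 1 - r := by field_simp; ring
  rw [he] at h
  rw [div_le_div_iff₀ hr hs0]
  have := mul_le_mul_of_nonneg_right h hs0.le
  have he2 : r / s * log (1 - s) * s = r * log (1 - s) := by field_simp
  linarith

/-- The negated logarithm of `(1 - v) / (1 + a v)`. -/
def mobiusLog (a v : ℝ) : ℝ := log (1 + a * v) - log (1 - v)

theorem hasDerivAt_mobiusLog {a v : ℝ} (ha : 0 < a) (h0 : 0 < v) (h1 : v < 1) :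
    HasDerivAt (mobiusLog a) ((a + 1) / ((1 + a * v) * (1 - v))) v := by
  have h2 : 0 < 1 + a * v := by positivity
  have h3 : 0 < 1 - v := by linarith
  have h4 := (((hasDerivAt_id v).const_mul a).const_add 1).log h2.ne'
  have h5 := ((hasDerivAt_id v).const_sub 1).log h3.ne'
  refine (h4.sub h5).congr_deriv ?_
  simp only [id]
  field_simp
  ring

theorem mobiusLog_eq {a v : ℝ} (ha : 0 < a) (h0 : 0 < v) (h1 : v < 1) :
    mobiusLog a v = -log (1 - (a + 1) * v / (1 + a * v)) := by
  have h2 : 0 < 1 + a * v := by positivity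
  have h3 : 0 < 1 - v := by linarith
  rw [show 1 - (a + 1) * v / (1 + a * v) = (1 - v) / (1 + a * v) by field_simp; ring,
    log_div h3.ne' h2.ne', mobiusLog]
  ring

theorem mobiusLog_pos {a v : ℝ} (ha : 0 < a) (h0 : 0 < v) (h1 : v < 1) : 0 < mobiusLog a v := by
  have h2 : 0 < a * v := by positivity
  have h4 : 0 < log (1 + a * v) := log_pos (by linarith)
  have h5 : log (1 - v) < 0 := log_neg (by linarith) (by linarith)
  unfold mobiusLog
  linarith

/-- The derivative of the ratio in `monotoneOn_mobiusLog_ratio` has this sign. With `w = v ^ k`, the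
claim is the product of two instances of `neg_log_one_sub_div_le`: one for `1 - v ≤ 1 - w`, where
`log w = k log v`, and one for the arguments that `mobiusLog_eq` attaches to `w` and `v`. -/
theorem mobiusLog_pow_mul_le {a v : ℝ} {k : ℕ} (hk : k ≠ 0) (ha : 0 < a) (h0 : 0 < v) (h1 : v < 1) :
    mobiusLog a (v ^ k) * ((a + 1) / ((1 + a * v) * (1 - v))) ≤
      (a + 1) / ((1 + a * v ^ k) * (1 - v ^ k)) * (k * v ^ (k - 1)) * mobiusLog a v := by
  have hw0 : 0 < v ^ k := by positivity
  have hwv : v ^ k ≤ v := pow_le_of_le_one h0.le h1.le hk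
  have hpow : v ^ (k - 1) = v ^ k / v := by
    rw [eq_div_iff h0.ne', pow_sub_one_mul hk]
  have hlog : log (v ^ k) = k * log v := by simp
  rw [hpow]
  generalize v ^ k = w at *
  have hw1 : w < 1 := hwv.trans_lt h1
  have hv2 : 0 < 1 + a * v := by positivity
  have hw2 : 0 < 1 + a * w := by positivity
  have hv3 : 0 < 1 - v := by linarith
  have hw3 : 0 < 1 - w := by linarith
  have htw : 0 < (a + 1) * w / (1 + a * w) := by positivity
  have htv : 0 < (a + 1) * v / (1 + a * v) := by positivity
  have htv1 : (a + 1) * v / (1 + a * v) < 1 := by rw [div_lt_one hv2]; linarith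
  have htwv : (a + 1) * w / (1 + a * w) ≤ (a + 1) * v / (1 + a * v) := by
    rw [div_le_div_iff₀ hw2 hv2]; nlinarith
  have hA := neg_log_one_sub_div_le hv3 (by linarith : 1 - v ≤ 1 - w) (by linarith)
  have hB := neg_log_one_sub_div_le htw htwv htv1
  rw [← mobiusLog_eq ha h0 h1, ← mobiusLog_eq ha hw0 hw1] at hB
  rw [sub_sub_cancel, sub_sub_cancel, hlog] at hA
  have hLw := mobiusLog_pos ha hw0 hw1
  have hlv : 0 < -log v := by linarith [log_neg h0 h1]
  have hk0 : (0 : ℝ) < k := by exact_mod_cast Nat.pos_of_ne_zero hk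
  have hAB := mul_le_mul hA hB (by positivity)
    (by rw [← mul_neg]; positivity)
  generalize mobiusLog a v = Lv at *
  generalize mobiusLog a w = Lw at *
  have e1 : -log v / (1 - v) * (Lw / ((a + 1) * w / (1 + a * w))) =
      (Lw * ((a + 1) / ((1 + a * v) * (1 - v)))) *
        (-log v * (1 + a * v) * (1 + a * w) / ((a + 1) ^ 2 * w)) := by
    field_simp
  have e2 : -(k * log v) / (1 - w) * (Lv / ((a + 1) * v / (1 + a * v))) =
      ((a + 1) / ((1 + a * w) * (1 - w)) * (k * (w / v)) * Lv) *
        (-log v * (1 + a * v) * (1 + a * w) / ((a + 1) ^ 2 * w)) := by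
    field_simp
  rw [e1, e2] at hAB
  exact le_of_mul_le_mul_right hAB (by positivity)

theorem monotoneOn_mobiusLog_ratio {a : ℝ} {k : ℕ} (hk : k ≠ 0) (ha : 0 < a) :
    MonotoneOn (fun v => mobiusLog a (v ^ k) / mobiusLog a v) (Set.Ioo 0 1) := by
  have hd : ∀ v ∈ Set.Ioo (0 : ℝ) 1, HasDerivAt (fun v => mobiusLog a (v ^ k) / mobiusLog a v)
      (((a + 1) / ((1 + a * v ^ k) * (1 - v ^ k)) * (k * v ^ (k - 1)) * mobiusLog a v -
        mobiusLog a (v ^ k) * ((a + 1) / ((1 + a * v) * (1 - v)))) / mobiusLog a v ^ 2) v := by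
    rintro v ⟨h0, h1⟩
    have hc := (hasDerivAt_mobiusLog ha (pow_pos h0 k) (pow_lt_one₀ h0.le h1 hk)).comp v
      (hasDerivAt_pow k v)
    exact hc.div (hasDerivAt_mobiusLog ha h0 h1) (mobiusLog_pos ha h0 h1).ne'
  refine monotoneOn_of_deriv_nonneg (convex_Ioo 0 1)
    (fun v hv => (hd v hv).continuousAt.continuousWithinAt) ?_ ?_
  · rw [interior_Ioo]
    exact fun v hv => (hd v hv).differentiableAt.differentiableWithinAt
  · rw [interior_Ioo]
    intro v hv
    rw [(hd v hv).deriv]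
    exact div_nonneg (sub_nonneg.2 (mobiusLog_pow_mul_le hk ha hv.1 hv.2)) (sq_nonneg _)

/-- Up to a negative factor, the slope of the growth rate at the point with parameter `v`. -/
def slopeSign (a c : ℝ) (k : ℕ) (v : ℝ) : ℝ := mobiusLog a v - (c - 1) * mobiusLog a (v ^ k)

theorem slopeSign_nonpos {a c : ℝ} {k : ℕ} (hk : k ≠ 0) (ha : 0 < a) (hc : 1 ≤ c) {v w : ℝ}
    (h0 : 0 < v) (hvw : v ≤ w) (h1 : w < 1) (h : slopeSign a c k v ≤ 0) :
    slopeSign a c k w ≤ 0 := by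
  have hv := mobiusLog_pos ha h0 (hvw.trans_lt h1)
  have hw := mobiusLog_pos ha (h0.trans_le hvw) h1
  have hm := monotoneOn_mobiusLog_ratio hk ha ⟨h0, hvw.trans_lt h1⟩ ⟨h0.trans_le hvw, h1⟩ hvw
  simp only at hm
  unfold slopeSign at *
  have h2 : 1 ≤ (c - 1) * (mobiusLog a (v ^ k) / mobiusLog a v) := by
    rw [← mul_div_assoc, one_le_div hv]; linarith
  have h3 : 1 ≤ (c - 1) * (mobiusLog a (w ^ k) / mobiusLog a w) :=
    h2.trans (mul_le_mul_of_nonneg_left hm (by linarith))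
  rw [← mul_div_assoc, one_le_div hw] at h3
  linarith

/-! ### The Gibbs parametrisation of the exponent -/

/-- The mean relative weight of the single parity check code of length `k + 1` under the Gibbs
measure of parameter `v`. -/
def gibbsWeight (a : ℝ) (k : ℕ) (v : ℝ) : ℝ :=
  a * (1 - v) * (1 - v ^ k) / ((a + 1) * (1 + a * v ^ (k + 1)))

theorem gibbsWeight_zero {a : ℝ} {k : ℕ} (hk : k ≠ 0) : gibbsWeight a k 0 = a / (a + 1) := by
  simp [gibbsWeight, hk]

theorem gibbsWeight_one (a : ℝ) (k : ℕ) : gibbsWeight a k 1 = 0 := by simp [gibbsWeight]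

theorem one_sub_gibbsWeight {a v : ℝ} {k : ℕ} (ha : 0 < a) (h0 : 0 ≤ v) :
    1 - gibbsWeight a k v =
      (1 + a * v) * (1 + a * v ^ k) / ((a + 1) * (1 + a * v ^ (k + 1))) := by
  have : 0 < 1 + a * v ^ (k + 1) := by positivity
  rw [gibbsWeight, eq_div_iff (by positivity), sub_mul, div_mul_cancel₀ _ (by positivity)]
  ring

/-- The derivative of `gibbsWeight`. -/
def gibbsWeightDeriv (a : ℝ) (k : ℕ) (v : ℝ) : ℝ :=
  -(a * (((1 - v ^ k) + (1 - v) * (k * v ^ (k - 1))) * (1 + a * v ^ (k + 1)) +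
    (1 - v) * (1 - v ^ k) * (a * ((k + 1) * v ^ k)))) / ((a + 1) * (1 + a * v ^ (k + 1)) ^ 2)

theorem hasDerivAt_gibbsWeight {a v : ℝ} {k : ℕ} (ha : 0 < a) (h0 : 0 < v) :
    HasDerivAt (gibbsWeight a k) (gibbsWeightDeriv a k v) v := by
  have h2 : 0 < 1 + a * v ^ (k + 1) := by positivity
  have hn := (((hasDerivAt_id v).const_sub 1).const_mul a).mul ((hasDerivAt_pow k v).const_sub 1)
  have hd := (((hasDerivAt_pow (k + 1) v).const_mul a).const_add 1).const_mul (a + 1)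
  refine (hn.div hd (by positivity)).congr_deriv ?_
  rw [gibbsWeightDeriv, div_eq_div_iff (by positivity) (by positivity)]
  simp only [id, Nat.add_sub_cancel, Nat.cast_add, Nat.cast_one, Pi.mul_apply]
  ring

theorem gibbsWeightDeriv_nonpos {a v : ℝ} {k : ℕ} (ha : 0 < a) (h0 : 0 < v) (h1 : v < 1) :
    gibbsWeightDeriv a k v ≤ 0 := by
  have h2 : 0 ≤ 1 - v := by linarith
  have h3 : 0 ≤ 1 - v ^ k := by linarith [pow_le_one₀ (n := k) h0.le h1.le]
  unfold gibbsWeightDeriv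
  refine div_nonpos_of_nonpos_of_nonneg ?_ (by positivity)
  rw [neg_nonpos]
  positivity

theorem continuousOn_gibbsWeight {a : ℝ} (k : ℕ) (ha : 0 < a) :
    ContinuousOn (gibbsWeight a k) (Set.Icc 0 1) := by
  unfold gibbsWeight
  refine ContinuousOn.div (by fun_prop) (by fun_prop) fun v hv => ?_
  have := hv.1
  positivity

theorem antitoneOn_gibbsWeight {a : ℝ} (k : ℕ) (ha : 0 < a) :
    AntitoneOn (gibbsWeight a k) (Set.Icc 0 1) := by
  refine antitoneOn_of_deriv_nonpos (convex_Icc 0 1) (continuousOn_gibbsWeight k ha) ?_ ?_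
  · rw [interior_Icc]
    exact fun v hv => (hasDerivAt_gibbsWeight ha hv.1).differentiableAt.differentiableWithinAt
  · rw [interior_Icc]
    intro v hv
    rw [(hasDerivAt_gibbsWeight ha hv.1).deriv]
    exact gibbsWeightDeriv_nonpos ha hv.1 hv.2

theorem exists_gibbsWeight_eq {a x : ℝ} {k : ℕ} (hk : k ≠ 0) (ha : 0 < a) (h0 : 0 < x)
    (h1 : x < a / (a + 1)) : ∃ v ∈ Set.Ioo (0 : ℝ) 1, gibbsWeight a k v = x := by
  obtain ⟨v, hv, rfl⟩ := intermediate_value_Icc' zero_le_one (continuousOn_gibbsWeight k ha)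
    (show x ∈ Set.Icc _ _ by
      rw [gibbsWeight_one, gibbsWeight_zero hk]; exact ⟨h0.le, h1.le⟩)
  refine ⟨v, ⟨lt_of_le_of_ne hv.1 ?_, lt_of_le_of_ne hv.2 ?_⟩, rfl⟩
  · rintro rfl
    rw [gibbsWeight_zero hk] at h1
    exact lt_irrefl _ h1
  · rintro rfl
    rw [gibbsWeight_one] at h0
    exact lt_irrefl _ h0

/-- The `q`-ary entropy with `a = q - 1`. -/
def entropy (a x : ℝ) : ℝ := x * log a - x * log x - (1 - x) * log (1 - x)

/-- The exponent in the Chernoff bound with parameter `z` for the mean number of codewords of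
relative weight `x`, where `G` is the weight enumerator of the check code. -/
def chernoffExponent (a c d : ℝ) (G : ℝ → ℝ) (x z : ℝ) : ℝ :=
  (1 - c) * entropy a x + c * (-(x * log z) + log (G z) / d)

/-- The optimal Chernoff exponent at the relative weight `gibbsWeight a k v`. -/
def gibbsExponent (a c : ℝ) (k : ℕ) (v : ℝ) : ℝ :=
  gibbsWeight a k v * slopeSign a c k v - log (1 + a * v) + (c - 1) * log (1 + a * v ^ k) -
    (c - 1 - c / (k + 1)) * log (1 + a * v ^ (k + 1)) + (1 - c / (k + 1)) * log (a + 1)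

/-- An envelope identity: the Chernoff parameter is stationary, so only the explicit dependence on
the relative weight contributes. The slope with respect to that weight is exactly `slopeSign`. -/
theorem hasDerivAt_gibbsExponent {a c v : ℝ} {k : ℕ} (hk : k ≠ 0) (ha : 0 < a) (h0 : 0 < v)
    (h1 : v < 1) :
    HasDerivAt (gibbsExponent a c k) (gibbsWeightDeriv a k v * slopeSign a c k v) v := by
  have hv2 : 0 < 1 + a * v := by positivity
  have hw2 : 0 < 1 + a * v ^ k := by positivity
  have hu2 : 0 < 1 + a * v ^ (k + 1) := by positivity
  have hv3 : 0 < 1 - v := by linarith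
  have hw3 : 0 < 1 - v ^ k := by linarith [pow_lt_one₀ h0.le h1 hk]
  have hS : HasDerivAt (slopeSign a c k) _ v := (hasDerivAt_mobiusLog ha h0 h1).sub
    (((hasDerivAt_mobiusLog ha (pow_pos h0 k) (pow_lt_one₀ h0.le h1 hk)).comp v
      (hasDerivAt_pow k v)).const_mul (c - 1))
  have hA := (((hasDerivAt_id v).const_mul a).const_add 1).log hv2.ne'
  have hB := ((((hasDerivAt_pow k v).const_mul a).const_add 1).log hw2.ne').const_mul (c - 1)
  have hC := ((((hasDerivAt_pow (k + 1) v).const_mul a).const_add 1).log hu2.ne').const_mul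
    (c - 1 - c / (k + 1))
  refine ((((((hasDerivAt_gibbsWeight (k := k) ha h0).mul hS).sub hA).add hB).sub hC).add_const
    ((1 - c / (k + 1)) * log (a + 1))).congr_deriv ?_
  have hp : v ^ k = v ^ (k - 1) * v := by rw [pow_sub_one_mul hk]
  have hk1 : (0 : ℝ) < k + 1 := by positivity
  simp only [id, Nat.add_sub_cancel, Nat.cast_add, Nat.cast_one, gibbsWeight]
  rw [pow_succ] at *
  generalize v ^ (k - 1) = p at *
  generalize v ^ k = w at *
  generalize slopeSign a c k v = S at *
  generalize gibbsWeightDeriv a k v = D at *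
  generalize hR : 1 + a * (w * v) = R at *
  field_simp
  rw [← hR, hp]
  ring

/-- The weight decreases in `v`, and `slopeSign` stays nonpositive once it is so. Hence from `v` the
exponent is monotone up to `w` if the sign at `v` is nonpositive, and otherwise antitone from `u` to
`v`. -/
theorem gibbsExponent_le_max {a c : ℝ} {k : ℕ} (hk : k ≠ 0) (ha : 0 < a) (hc : 1 ≤ c)
    {u v w : ℝ} (h0 : 0 < u) (huv : u ≤ v) (hvw : v ≤ w) (h1 : w < 1) :
    gibbsExponent a c k v ≤ max (gibbsExponent a c k u) (gibbsExponent a c k w) := by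
  have hcont : ContinuousOn (gibbsExponent a c k) (Set.Ioo 0 1) := fun x hx =>
    (hasDerivAt_gibbsExponent hk ha hx.1 hx.2).continuousAt.continuousWithinAt
  have hdiff : DifferentiableOn ℝ (gibbsExponent a c k) (Set.Ioo 0 1) := fun x hx =>
    (hasDerivAt_gibbsExponent hk ha hx.1 hx.2).differentiableAt.differentiableWithinAt
  rcases le_or_gt (slopeSign a c k v) 0 with hS | hS
  · refine le_max_of_le_right ?_
    have hsub : Set.Icc v w ⊆ Set.Ioo 0 1 := fun x hx =>
      ⟨(h0.trans_le huv).trans_le hx.1, hx.2.trans_lt h1⟩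
    refine monotoneOn_of_deriv_nonneg (convex_Icc v w) (hcont.mono hsub)
      (hdiff.mono (interior_subset.trans hsub)) (fun x hx => ?_) ⟨le_rfl, hvw⟩ ⟨hvw, le_rfl⟩ hvw
    have hx' := interior_subset hx
    have hx01 := hsub hx'
    rw [(hasDerivAt_gibbsExponent hk ha hx01.1 hx01.2).deriv]
    exact mul_nonneg_of_nonpos_of_nonpos (gibbsWeightDeriv_nonpos ha hx01.1 hx01.2)
      (slopeSign_nonpos hk ha hc (h0.trans_le huv) hx'.1 hx01.2 hS)
  · refine le_max_of_le_left ?_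
    have hsub : Set.Icc u v ⊆ Set.Ioo 0 1 := fun x hx =>
      ⟨h0.trans_le hx.1, (hx.2.trans hvw).trans_lt h1⟩
    refine antitoneOn_of_deriv_nonpos (convex_Icc u v) (hcont.mono hsub)
      (hdiff.mono (interior_subset.trans hsub)) (fun x hx => ?_) ⟨le_rfl, huv⟩ ⟨huv, le_rfl⟩ huv
    have hx01 := hsub (interior_subset hx)
    rw [interior_Icc] at hx
    rw [(hasDerivAt_gibbsExponent hk ha hx01.1 hx01.2).deriv]
    refine mul_nonpos_of_nonpos_of_nonneg (gibbsWeightDeriv_nonpos ha hx01.1 hx01.2) ?_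
    by_contra! hneg
    exact hS.not_ge (slopeSign_nonpos hk ha hc hx01.1 hx.2.le (hvw.trans_lt h1) hneg.le)

/-- With `z = (1 - v) / (1 + a v)` both `1 + a z` and `1 - z` become multiples of `(a + 1) / (1 + a
v)`, so the enumerator, the weight and its complement all factor and the logarithms split. -/
theorem chernoffExponent_eq_gibbsExponent {a c v : ℝ} {k : ℕ} {G : ℝ → ℝ} (hk : k ≠ 0) (ha : 0 < a)
    (hG : ∀ z, (a + 1) * G z = (1 + a * z) ^ (k + 1) + a * (1 - z) ^ (k + 1))
    (h0 : 0 < v) (h1 : v < 1) :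
    chernoffExponent a c (k + 1) G (gibbsWeight a k v) ((1 - v) / (1 + a * v)) =
      gibbsExponent a c k v := by
  have hv2 : 0 < 1 + a * v := by positivity
  have hw2 : 0 < 1 + a * v ^ k := by positivity
  have hu2 : 0 < 1 + a * v ^ (k + 1) := by positivity
  have hv3 : 0 < 1 - v := by linarith
  have hw3 : 0 < 1 - v ^ k := by linarith [pow_lt_one₀ h0.le h1 hk]
  have ha1 : 0 < a + 1 := by linarith
  have hGz : G ((1 - v) / (1 + a * v)) =
      ((a + 1) / (1 + a * v)) ^ (k + 1) * (1 + a * v ^ (k + 1)) / (a + 1) := by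
    rw [eq_div_iff ha1.ne', mul_comm, hG,
      show 1 + a * ((1 - v) / (1 + a * v)) = (a + 1) / (1 + a * v) by field_simp; ring,
      show 1 - (1 - v) / (1 + a * v) = (a + 1) / (1 + a * v) * v by field_simp; ring, mul_pow]
    ring
  have hlogG : log (G ((1 - v) / (1 + a * v))) =
      (k + 1) * (log (a + 1) - log (1 + a * v)) + log (1 + a * v ^ (k + 1)) - log (a + 1) := by
    rw [hGz, log_div (by positivity) ha1.ne', log_mul (by positivity) hu2.ne', log_pow,
      log_div ha1.ne' hv2.ne']
    push_cast
    ring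
  have hlogX : log (gibbsWeight a k v) = log a + log (1 - v) + log (1 - v ^ k) -
      (log (a + 1) + log (1 + a * v ^ (k + 1))) := by
    rw [gibbsWeight, log_div (by positivity) (by positivity), log_mul (by positivity) hw3.ne',
      log_mul ha.ne' hv3.ne', log_mul ha1.ne' hu2.ne']
  have hlogY : log (1 - gibbsWeight a k v) = log (1 + a * v) + log (1 + a * v ^ k) -
      (log (a + 1) + log (1 + a * v ^ (k + 1))) := by
    rw [one_sub_gibbsWeight ha h0.le, log_div (by positivity) (by positivity),
      log_mul hv2.ne' hw2.ne', log_mul ha1.ne' hu2.ne']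
  have hk1 : (0 : ℝ) < k + 1 := by positivity
  rw [chernoffExponent, entropy, hlogG, hlogX, hlogY, log_div hv3.ne' hv2.ne', gibbsExponent,
    slopeSign, mobiusLog, mobiusLog]
  field_simp
  ring

end Analysis

/-! ### Binomial estimates by entropy -/

section Bounds

open Real

theorem pow_eq_exp {x : ℝ} (hx : 0 < x) (m : ℕ) : x ^ m = exp (m * log x) := by
  rw [mul_comm, exp_mul, exp_log hx, rpow_natCast]

theorem choose_mul_pow_le (n l : ℕ) (hl : l ≤ n) :
    n.choose l * (l ^ l * (n - l) ^ (n - l)) ≤ n ^ n := by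
  calc _ = l ^ l * (n - l) ^ (n - l) * n.choose l := by ring
    _ ≤ ∑ m ∈ Finset.range (n + 1), l ^ m * (n - l) ^ (n - m) * n.choose m :=
        Finset.single_le_sum (f := fun m => l ^ m * (n - l) ^ (n - m) * n.choose m)
          (fun _ _ => Nat.zero_le _) (Finset.mem_range.2 (Nat.lt_succ_of_le hl))
    _ = n ^ n := by
        have h := add_pow l (n - l) n
        rw [Nat.add_sub_cancel' hl] at h
        rw [h]
        simp

theorem factorial_mul_pow_le (l j : ℕ) : l.factorial * l ^ j ≤ j.factorial * l ^ l := by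
  rcases le_total l j with h | h
  · calc l.factorial * l ^ j = l.factorial * l ^ (j - l) * l ^ l := by
          rw [mul_assoc, ← pow_add, Nat.sub_add_cancel h]
      _ ≤ _ := Nat.mul_le_mul_right _ (Nat.factorial_mul_pow_sub_le_factorial h)
  · have h1 : l.factorial ≤ j.factorial * l ^ (l - j) := by
      rw [← Nat.factorial_mul_descFactorial (Nat.sub_le l j), Nat.sub_sub_self h]
      exact Nat.mul_le_mul_left _ (Nat.descFactorial_le_pow _ _)
    calc l.factorial * l ^ j ≤ j.factorial * l ^ (l - j) * l ^ j := Nat.mul_le_mul_right _ h1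
      _ = _ := by rw [mul_assoc, ← pow_add, Nat.sub_add_cancel h]

theorem choose_mul_pow_le_mode (n l j : ℕ) (hl : l ≤ n) (hj : j ≤ n) :
    n.choose j * (l ^ j * (n - l) ^ (n - j)) ≤ n.choose l * (l ^ l * (n - l) ^ (n - l)) := by
  have h1 := factorial_mul_pow_le l j
  have h2 := factorial_mul_pow_le (n - l) (n - j)
  have h3 := Nat.mul_le_mul h1 h2
  have hj' := Nat.choose_mul_factorial_mul_factorial hj
  have hl' := Nat.choose_mul_factorial_mul_factorial hl
  refine Nat.le_of_mul_le_mul_left ?_ (Nat.mul_pos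
    (Nat.mul_pos j.factorial_pos (n - j).factorial_pos)
    (Nat.mul_pos l.factorial_pos (n - l).factorial_pos))
  calc _ = n.choose j * j.factorial * (n - j).factorial *
        (l.factorial * l ^ j * ((n - l).factorial * (n - l) ^ (n - j))) := by ring
    _ ≤ n.choose j * j.factorial * (n - j).factorial *
        (j.factorial * l ^ l * ((n - j).factorial * (n - l) ^ (n - l))) :=
        Nat.mul_le_mul_left _ h3
    _ = n.choose l * l.factorial * (n - l).factorial *
        (j.factorial * l ^ l * ((n - j).factorial * (n - l) ^ (n - l))) := by rw [hj', hl']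
    _ = _ := by ring

/-- In the expansion of `(l + (n - l)) ^ n` the term of index `l` is the largest of `n + 1` terms.
-/
theorem pow_self_le_mul_choose (n l : ℕ) (hl : l ≤ n) :
    n ^ n ≤ (n + 1) * (n.choose l * (l ^ l * (n - l) ^ (n - l))) := by
  have h := add_pow l (n - l) n
  rw [Nat.add_sub_cancel' hl] at h
  calc n ^ n = ∑ m ∈ Finset.range (n + 1), l ^ m * (n - l) ^ (n - m) * n.choose m := by
        rw [h]; simp
    _ ≤ (Finset.range (n + 1)).card • (n.choose l * (l ^ l * (n - l) ^ (n - l))) := by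
        refine Finset.sum_le_card_nsmul _ _ _ fun j hj => ?_
        rw [mul_comm]
        exact choose_mul_pow_le_mode n l j hl (Nat.lt_succ_iff.1 (Finset.mem_range.1 hj))
    _ = _ := by simp

theorem pow_le_choose_mul_pow {n l : ℕ} (hl : l ≤ n) : n ^ l ≤ n.choose l * l ^ l := by
  have h : ∏ i ∈ Finset.range l, (n * (l - i)) ≤ ∏ i ∈ Finset.range l, ((n - i) * l) := by
    refine Finset.prod_le_prod' fun i hi => ?_
    have hil := (Finset.mem_range.1 hi).le
    obtain ⟨r, rfl⟩ := Nat.exists_eq_add_of_le hil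
    obtain ⟨s, rfl⟩ := Nat.exists_eq_add_of_le hl
    have e1 : i + r - i = r := by omega
    have e2 : i + r + s - i = r + s := by omega
    rw [e1, e2]
    nlinarith [Nat.zero_le (s * i)]
  rw [Finset.prod_mul_distrib, Finset.prod_mul_distrib, ← Nat.descFactorial_eq_prod_range,
    ← Nat.descFactorial_eq_prod_range, Nat.descFactorial_self, Finset.prod_const, Finset.prod_const,
    Finset.card_range, Nat.descFactorial_eq_factorial_mul_choose] at h
  exact Nat.le_of_mul_le_mul_left (by linarith) l.factorial_pos

theorem exp_mul_entropy {a : ℝ} (ha : 0 < a) {n l : ℕ} (h0 : 0 < l) (hl : l < n) :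
    exp (n * entropy a (l / n)) * ((l ^ l * (n - l) ^ (n - l) : ℕ) : ℝ) =
      a ^ l * ((n ^ n : ℕ) : ℝ) := by
  have hn : (0 : ℝ) < n := by exact_mod_cast h0.trans hl
  have hl' : (0 : ℝ) < l := by exact_mod_cast h0
  have hr : (0 : ℝ) < (n - l : ℕ) := by exact_mod_cast Nat.sub_pos_of_lt hl
  have hr' : ((n - l : ℕ) : ℝ) = n - l := Nat.cast_sub hl.le
  push_cast
  rw [pow_eq_exp hl', pow_eq_exp hr, pow_eq_exp hn, pow_eq_exp ha, ← exp_add, ← exp_add, ← exp_add, entropy,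
    show (1 : ℝ) - l / n = (n - l : ℕ) / n by rw [hr']; field_simp, log_div hl'.ne' hn.ne',
    log_div hr.ne' hn.ne', hr']
  congr 1
  field_simp
  ring

theorem choose_mul_pow_le_exp_entropy {a : ℝ} (ha : 0 < a) {n l : ℕ} (h0 : 0 < l) (hl : l < n) :
    n.choose l * a ^ l ≤ exp (n * entropy a (l / n)) := by
  have hpos : (0 : ℝ) < (l ^ l * (n - l) ^ (n - l) : ℕ) := by
    exact_mod_cast Nat.mul_pos (pow_pos h0 _) (pow_pos (Nat.sub_pos_of_lt hl) _)
  refine le_of_mul_le_mul_right ?_ hpos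
  rw [exp_mul_entropy ha h0 hl, mul_right_comm, mul_comm]
  gcongr
  exact_mod_cast choose_mul_pow_le n l hl.le

theorem exp_entropy_le_mul_choose {a : ℝ} (ha : 0 < a) {n l : ℕ} (h0 : 0 < l) (hl : l < n) :
    exp (n * entropy a (l / n)) ≤ (n + 1) * (n.choose l * a ^ l) := by
  have hpos : (0 : ℝ) < (l ^ l * (n - l) ^ (n - l) : ℕ) := by
    exact_mod_cast Nat.mul_pos (pow_pos h0 _) (pow_pos (Nat.sub_pos_of_lt hl) _)
  refine le_of_mul_le_mul_right ?_ hpos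
  rw [exp_mul_entropy ha h0 hl]
  have h : ((n ^ n : ℕ) : ℝ) ≤
      (n + 1) * (n.choose l * ((l ^ l * (n - l) ^ (n - l) : ℕ) : ℝ)) := by
    exact_mod_cast pow_self_le_mul_choose n l hl.le
  calc _ ≤ a ^ l * ((n + 1) * (n.choose l * ((l ^ l * (n - l) ^ (n - l) : ℕ) : ℝ))) := by gcongr
    _ = _ := by ring

/-! ### Chernoff bounds and negativity of the exponent -/

/-- The tangent line inequality for the cumulant generating function of a counting measure. -/
theorem log_sum_pow_sub_le {ι : Type*} {s : Finset ι} (hs : s.Nonempty) (w : ι → ℕ) {z z₁ μ : ℝ}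
    (hz : 0 < z) (hz₁ : 0 < z₁) (hμ : ∑ i ∈ s, (w i : ℝ) * z₁ ^ w i = μ * ∑ i ∈ s, z₁ ^ w i) :
    log (∑ i ∈ s, z₁ ^ w i) - μ * log z₁ ≤ log (∑ i ∈ s, z ^ w i) - μ * log z := by
  have hpos : ∀ y : ℝ, 0 < y → 0 < ∑ i ∈ s, y ^ w i := fun y hy =>
    Finset.sum_pos (fun i _ => by positivity) hs
  -- This is `1 + x ≤ exp x` term by term; after summation the linear parts cancel because `μ` is
  -- the tilted mean.
  have hterm : ∀ i, exp (μ * (log z - log z₁)) *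
      (z₁ ^ w i * (1 + (w i - μ) * (log z - log z₁))) ≤ z ^ w i := by
    intro i
    have h := add_one_le_exp ((w i - μ) * (log z - log z₁))
    calc _ ≤ exp (μ * (log z - log z₁)) *
          (z₁ ^ w i * exp ((w i - μ) * (log z - log z₁))) := by gcongr; linarith
      _ = _ := by
        rw [pow_eq_exp hz, pow_eq_exp hz₁, ← exp_add, ← exp_add]
        congr 1
        ring
  have hsum := Finset.sum_le_sum fun i (_ : i ∈ s) => hterm i
  rw [← Finset.mul_sum] at hsum
  have he : ∑ i ∈ s, z₁ ^ w i * (1 + (w i - μ) * (log z - log z₁)) = ∑ i ∈ s, z₁ ^ w i := by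
    have h0 : ∑ i ∈ s, ((w i : ℝ) * z₁ ^ w i - μ * z₁ ^ w i) = 0 := by
      rw [Finset.sum_sub_distrib, ← Finset.mul_sum, hμ, sub_self]
    calc _ = ∑ i ∈ s, (z₁ ^ w i + (log z - log z₁) * ((w i : ℝ) * z₁ ^ w i - μ * z₁ ^ w i)) :=
          Finset.sum_congr rfl fun i _ => by ring
      _ = _ := by rw [Finset.sum_add_distrib, ← Finset.mul_sum, h0, mul_zero, add_zero]
  rw [he] at hsum
  have hlog := log_le_log (mul_pos (exp_pos _) (hpos z₁ hz₁)) hsum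
  rw [log_mul (exp_pos _).ne' (hpos z₁ hz₁).ne', log_exp] at hlog
  linarith

variable {F : Type*} [Field F] [Fintype F] [DecidableEq F]

/-- Obtained by differentiating both sides of the MacWilliams identity. It identifies the parameter
at which the tilted mean is the prescribed weight. -/
theorem mean_weight_singleCheck {k : ℕ} {v a : ℝ} (ha : a = (Fintype.card F : ℝ) - 1)
    (h0 : 0 < v) (h1 : v < 1) :
    ∑ u ∈ singleCheck F (k + 1), (hammingNorm u : ℝ) * ((1 - v) / (1 + a * v)) ^ hammingNorm u =
      (k + 1) * gibbsWeight a k v * weightEnum F (k + 1) ((1 - v) / (1 + a * v)) := by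
  have ha1 : 1 ≤ a := ha ▸ one_le_card_sub_one
  have hq : (Fintype.card F : ℝ) = a + 1 := by rw [ha]; ring
  have hv2 : 0 < 1 + a * v := by positivity
  have hv3 : 0 < 1 - v := by linarith
  have hu2 : 0 < 1 + a * v ^ (k + 1) := by positivity
  have hG := card_mul_weightEnum (F := F) (k + 1)
  simp only [hq, add_sub_cancel_right] at hG
  have e1 : 1 + a * ((1 - v) / (1 + a * v)) = (a + 1) / (1 + a * v) := by field_simp; ring
  have e2 : 1 - (1 - v) / (1 + a * v) = (a + 1) / (1 + a * v) * v := by field_simp; ring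
  have hz : 0 < (1 - v) / (1 + a * v) := by positivity
  have hd1 : HasDerivAt (fun z => (a + 1) * weightEnum F (k + 1) z)
      ((a + 1) * ∑ u ∈ singleCheck F (k + 1),
        (hammingNorm u : ℝ) * ((1 - v) / (1 + a * v)) ^ (hammingNorm u - 1))
      ((1 - v) / (1 + a * v)) := by
    refine HasDerivAt.const_mul _ ?_
    unfold weightEnum
    exact HasDerivAt.fun_sum fun u _ => hasDerivAt_pow _ _
  have hd2 := ((((hasDerivAt_id ((1 - v) / (1 + a * v))).const_mul a).const_add 1).pow (k + 1)).add
    ((((hasDerivAt_id ((1 - v) / (1 + a * v))).const_sub 1).pow (k + 1)).const_mul a)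
  have huniq := hd1.unique (hd2.congr_of_eventuallyEq (Eventually.of_forall hG))
  simp only [id, e1, e2, Nat.add_sub_cancel] at huniq
  have hGz := hG ((1 - v) / (1 + a * v))
  rw [e1, e2] at hGz
  have hmul : ∑ u ∈ singleCheck F (k + 1),
      (hammingNorm u : ℝ) * ((1 - v) / (1 + a * v)) ^ hammingNorm u =
      (1 - v) / (1 + a * v) * ∑ u ∈ singleCheck F (k + 1),
        (hammingNorm u : ℝ) * ((1 - v) / (1 + a * v)) ^ (hammingNorm u - 1) := by
    rw [Finset.mul_sum]
    refine Finset.sum_congr rfl fun u _ => ?_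
    rcases Nat.eq_zero_or_pos (hammingNorm u) with h | h
    · simp [h]
    · rw [mul_left_comm, mul_comm ((1 - v) / (1 + a * v)), pow_sub_one_mul h.ne']
  rw [hmul]
  have ha2 : a + 1 ≠ 0 := by positivity
  refine mul_left_cancel₀ ha2 ?_
  rw [mul_left_comm, huniq, mul_left_comm (a + 1), hGz, gibbsWeight, mul_pow, mul_pow]
  push_cast
  generalize hP : (a + 1) / (1 + a * v) = P
  have hP' : a + 1 = P * (1 + a * v) := by rw [← hP]; field_simp
  rw [pow_succ P k]
  generalize P ^ k = Q
  have hP0 : P ≠ 0 := by rw [← hP]; positivity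
  rw [hP']
  field_simp
  ring

/-- The Gibbs parameter minimises the Chernoff exponent, so negativity at any `z` passes to
`gibbsExponent`. -/
theorem gibbsExponent_le_chernoffExponent {k : ℕ} (hk : k ≠ 0) {v a c z : ℝ}
    (ha : a = (Fintype.card F : ℝ) - 1) (hc : 0 ≤ c) (h0 : 0 < v) (h1 : v < 1) (hz : 0 < z) :
    gibbsExponent a c k v ≤
      chernoffExponent a c (k + 1) (weightEnum F (k + 1)) (gibbsWeight a k v) z := by
  have ha1 : 1 ≤ a := ha ▸ one_le_card_sub_one
  have hq : (Fintype.card F : ℝ) = a + 1 := by rw [ha]; ring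
  have hG := card_mul_weightEnum (F := F) (k + 1)
  simp only [hq, add_sub_cancel_right] at hG
  have hv3 : 0 < 1 - v := by linarith
  rw [← chernoffExponent_eq_gibbsExponent hk (by linarith) hG h0 h1]
  have h := log_sum_pow_sub_le (s := singleCheck F (k + 1)) ⟨0, zero_mem_singleCheck _⟩
    hammingNorm hz (by positivity) (mean_weight_singleCheck ha h0 h1)
  change log (weightEnum F (k + 1) _) - _ ≤ log (weightEnum F (k + 1) _) - _ at h
  unfold chernoffExponent
  have hk1 : (0 : ℝ) < k + 1 := by positivity
  gcongr (1 - c) * entropy a (gibbsWeight a k v) + c * ?_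
  rw [neg_add_eq_sub, neg_add_eq_sub, ← mul_le_mul_iff_right₀ hk1]
  have e : ∀ G y : ℝ, (k + 1 : ℝ) * (G / (k + 1) - y) = G - (k + 1) * y := fun G y => by
    field_simp
  rw [e, e]
  linarith

/-- The factor `c n + 1` is lost in bounding the sphere of weight `c l` from below; that sphere also
accounts for the `-c` in the coefficient `1 - c` of the entropy. -/
theorem meanWeight_le_exp {c d n l : ℕ} {a z : ℝ} (ha : a = (Fintype.card F : ℝ) - 1)
    (hc : 0 < c) (hd : 0 < d) (hdn : d ∣ c * n) (h0 : 0 < l) (hl : l < n) (hz : 0 < z) :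
    meanWeight F c d n l ≤
      (c * n + 1) * exp (n * chernoffExponent a c d (weightEnum F d) (l / n) z) := by
  have ha1 : 1 ≤ a := ha ▸ one_le_card_sub_one
  have ha0 : 0 < a := by linarith
  have hG : 0 < weightEnum F d z := one_pos.trans_le (one_le_weightEnum d hz.le)
  have hn : (0 : ℝ) < n := by exact_mod_cast h0.trans hl
  have hc' : (0 : ℝ) < c := by exact_mod_cast hc
  have hd' : (0 : ℝ) < d := by exact_mod_cast hd
  have hcl : c * l < c * n := Nat.mul_lt_mul_of_pos_left hl hc
  have hA := choose_mul_pow_le_exp_entropy ha0 h0 hl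
  have hB := exp_entropy_le_mul_choose ha0 (Nat.mul_pos hc h0) hcl
  have hC := checkCount_le (F := F) (w := c * l) hdn hz
  have hch : (0 : ℝ) < (c * n).choose (c * l) := by exact_mod_cast Nat.choose_pos hcl.le
  have hfrac : ((c * l : ℕ) : ℝ) / ((c * n : ℕ) : ℝ) = l / n := by
    push_cast
    rw [mul_div_mul_left _ _ hc'.ne']
  rw [hfrac] at hB
  push_cast at hB
  have hzw : z ^ (c * l) = exp (c * l * log z) := by
    rw [pow_eq_exp hz, Nat.cast_mul]
  have hGw : weightEnum F d z ^ (c * n / d) = exp (c * n / d * log (weightEnum F d z)) := by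
    rw [pow_eq_exp hG, Nat.cast_div hdn hd'.ne', Nat.cast_mul]
  rw [hzw, hGw, ← le_div_iff₀ (exp_pos _), ← exp_sub] at hC
  unfold meanWeight
  rw [← ha, div_le_iff₀ (by positivity)]
  calc (n.choose l : ℝ) * a ^ l * checkCount F d (c * n) (c * l)
      ≤ exp (n * entropy a (l / n)) *
        exp (c * n / d * log (weightEnum F d z) - c * l * log z) := by gcongr
    _ = exp (n * chernoffExponent a c d (weightEnum F d) (l / n) z) *
        exp (c * n * entropy a (l / n)) := by
        rw [← exp_add, ← exp_add, chernoffExponent]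
        congr 1
        field_simp
        ring
    _ ≤ exp (n * chernoffExponent a c d (weightEnum F d) (l / n) z) *
        ((c * n + 1) * ((c * n).choose (c * l) * a ^ (c * l))) := by gcongr
    _ = _ := by ring

theorem exists_chernoffExponent_neg {q c d : ℕ} {a x : ℝ} (hq : Fintype.card F = q)
    (ha : a = (q : ℝ) - 1) (hc : 0 < c) (hd : 0 < d) (hx0 : 0 < x) (hx1 : x < 1)
    (hω : omega q c d x < 0) :
    ∃ z > 0, chernoffExponent a c d (weightEnum F d) x z < 0 := by
  have hc' : (0 : ℝ) < c := by exact_mod_cast hc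
  have hd' : (0 : ℝ) < d := by exact_mod_cast hd
  have hcd : (0 : ℝ) < c / d := by positivity
  have ha1 : 1 ≤ a := by rw [ha, ← hq]; exact one_le_card_sub_one
  have hq' : (q : ℝ) = a + 1 := by rw [ha]; ring
  have hent : Real.qaryEntropy q x = entropy a x := by
    rw [Real.qaryEntropy, Real.binEntropy, entropy, log_inv, log_inv, ha]
    push_cast
    ring
  obtain ⟨y, ⟨hy0, hy1⟩, hy⟩ : ∃ y ∈ Set.Ioo (0 : ℝ) 1,
      entropy a x + (c : ℝ) / d * (d * divergence x y + rho q d y - log q) < 0 := by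
    -- Only a lower bound on the infimum is needed, so nonemptiness of the set suffices.
    by_contra! hcon
    refine hω.not_ge ?_
    have : log q - entropy a x / ((c : ℝ) / d) ≤ delta q d x := by
      refine le_csInf ((Set.nonempty_Ioo.2 one_pos).image _) ?_
      rintro _ ⟨y, hy, rfl⟩
      have := hcon y hy
      rw [sub_le_iff_le_add, ← sub_le_iff_le_add', le_div_iff₀ hcd]
      simp only
      linarith
    rw [sub_le_comm, le_div_iff₀ hcd] at this
    rw [omega, hent]
    linarith
  have hy2 : 0 < 1 - y := by linarith
  have ha0 : 0 < a := by linarith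
  -- This substitution turns the divergence form of the exponent into the Chernoff form, with
  -- equality.
  refine ⟨y / (a * (1 - y)), by positivity, ?_⟩
  have hz : 0 < y / (a * (1 - y)) := by positivity
  have hG : 0 < weightEnum F d (y / (a * (1 - y))) :=
    one_pos.trans_le (one_le_weightEnum d hz.le)
  have hGeq := card_mul_weightEnum (F := F) d (y / (a * (1 - y)))
  rw [hq, hq', add_sub_cancel_right,
    show 1 + a * (y / (a * (1 - y))) = 1 / (1 - y) by field_simp; ring,
    show 1 - y / (a * (1 - y)) = 1 / (1 - y) * (1 - (a + 1) * y / a) by field_simp; ring,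
    mul_pow] at hGeq
  have hR : 1 + a * (1 - (a + 1) * y / a) ^ d =
      (a + 1) * weightEnum F d (y / (a * (1 - y))) * (1 - y) ^ d := by
    rw [hGeq, one_div, inv_pow]
    field_simp
  have hrho : rho q d y =
      log (a + 1) + log (weightEnum F d (y / (a * (1 - y)))) + d * log (1 - y) := by
    rw [rho, hq', add_sub_cancel_right, hR, log_mul (by positivity) (by positivity),
      log_mul (by positivity) hG.ne', log_pow]
  rw [hrho, hq', divergence, log_div hx0.ne' hy0.ne',
    log_div (by linarith : (1 - x : ℝ) ≠ 0) hy2.ne'] at hy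
  rw [chernoffExponent, log_div hy0.ne' (by positivity), log_mul ha0.ne' hy2.ne']
  refine lt_of_eq_of_lt ?_ hy
  rw [entropy]
  field_simp
  ring

/-- With `z = √x` the exponent is at most `x ((c/2 - 1) log x + c q^d)`; since `c ≥ 3`, the
logarithm wins for small `x`. -/
theorem chernoffExponent_sqrt_neg {c d : ℕ} {a x : ℝ} (ha : a = (Fintype.card F : ℝ) - 1)
    (hc : 3 ≤ c) (hd : 0 < d) (hx0 : 0 < x)
    (hx : x < exp (-(2 * c * (Fintype.card F : ℝ) ^ d))) :
    chernoffExponent a c d (weightEnum F d) x (√x) < 0 := by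
  have ha1 : 1 ≤ a := ha ▸ one_le_card_sub_one
  have hc' : (3 : ℝ) ≤ c := by exact_mod_cast hc
  have hd' : (1 : ℝ) ≤ d := by exact_mod_cast hd
  have hlogx : log x < -(2 * c * (Fintype.card F : ℝ) ^ d) := (log_lt_iff_lt_exp hx0).2 hx
  have hH : (0 : ℝ) ≤ 2 * c * (Fintype.card F : ℝ) ^ d := by positivity
  have hx1 : x < 1 := hx.trans_le (exp_le_one_iff.2 (by linarith))
  have hE : -(x * log x) ≤ entropy a x := by
    have h1 : 0 ≤ x * log a := mul_nonneg hx0.le (log_nonneg ha1)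
    have h2 : (1 - x) * log (1 - x) ≤ 0 :=
      mul_nonpos_of_nonneg_of_nonpos (by linarith) (log_nonpos (by linarith) (by linarith))
    unfold entropy
    linarith
  have hGpos : 0 < weightEnum F d (√x) := one_pos.trans_le (one_le_weightEnum d (sqrt_nonneg x))
  have hG : log (weightEnum F d (√x)) / d ≤ (Fintype.card F : ℝ) ^ d * x := by
    have h1 := weightEnum_le (F := F) d (sqrt_nonneg x) (sqrt_le_one.2 hx1.le)
    rw [sq_sqrt hx0.le] at h1
    have h2 := log_le_sub_one_of_pos hGpos
    rw [div_le_iff₀ (by linarith)]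
    have h3 : 0 ≤ (Fintype.card F : ℝ) ^ d * x := by positivity
    nlinarith
  rw [chernoffExponent, log_sqrt hx0.le]
  have h1 : (1 - (c : ℝ)) * entropy a x ≤ (1 - c) * -(x * log x) :=
    mul_le_mul_of_nonpos_left hE (by linarith)
  have h2 : (c : ℝ) * (-(x * (log x / 2)) + log (weightEnum F d (√x)) / d) ≤
      c * (-(x * (log x / 2)) + (Fintype.card F : ℝ) ^ d * x) := by gcongr
  have h3 : x * ((c / 2 - 1) * log x + c * (Fintype.card F : ℝ) ^ d) < 0 := by
    refine mul_neg_of_pos_of_neg hx0 ?_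
    nlinarith
  linarith

theorem exists_chernoffExponent_le {k : ℕ} (hk : k ≠ 0) {a c ε α z z' : ℝ}
    (ha : a = (Fintype.card F : ℝ) - 1) (hc : 1 ≤ c) (hε : 0 < ε) (hεα : ε < α)
    (hα : α < a / (a + 1)) (hz : 0 < z) (hz' : 0 < z')
    (hzε : chernoffExponent a c (k + 1) (weightEnum F (k + 1)) ε z < 0)
    (hzα : chernoffExponent a c (k + 1) (weightEnum F (k + 1)) α z' < 0) :
    ∃ η > 0, ∀ x, ε ≤ x → x ≤ α →
      ∃ y > 0, chernoffExponent a c (k + 1) (weightEnum F (k + 1)) x y ≤ -η := by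
  have ha1 : 1 ≤ a := ha ▸ one_le_card_sub_one
  have ha0 : 0 < a := by linarith
  have hq : (Fintype.card F : ℝ) = a + 1 := by rw [ha]; ring
  have hG := card_mul_weightEnum (F := F) (k + 1)
  simp only [hq, add_sub_cancel_right] at hG
  obtain ⟨u, ⟨hu0, hu1⟩, rfl⟩ := exists_gibbsWeight_eq hk ha0 (hε.trans hεα) hα
  obtain ⟨w, ⟨hw0, hw1⟩, rfl⟩ := exists_gibbsWeight_eq hk ha0 hε (hεα.trans hα)
  -- The parameter runs opposite to the weight: `u` belongs to α and `w` to ε.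
  have huw : u ≤ w := by
    by_contra! h
    exact hεα.not_ge (antitoneOn_gibbsWeight k ha0 ⟨hw0.le, hw1.le⟩ ⟨hu0.le, hu1.le⟩ h.le)
  have hu := (gibbsExponent_le_chernoffExponent hk ha (by linarith) hu0 hu1 hz').trans_lt hzα
  have hw := (gibbsExponent_le_chernoffExponent hk ha (by linarith) hw0 hw1 hz).trans_lt hzε
  refine ⟨-max (gibbsExponent a c k u) (gibbsExponent a c k w),
    neg_pos.2 (max_lt hu hw), fun x hx1 hx2 => ?_⟩
  obtain ⟨v, ⟨huv, hvw⟩, rfl⟩ := intermediate_value_Icc' huw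
    ((continuousOn_gibbsWeight k ha0).mono (Set.Icc_subset_Icc hu0.le hw1.le)) ⟨hx1, hx2⟩
  have hv0 := hu0.trans_le huv
  have hv1 := hvw.trans_lt hw1
  have hv3 : 0 < 1 - v := by linarith
  refine ⟨(1 - v) / (1 + a * v), by positivity, ?_⟩
  rw [chernoffExponent_eq_gibbsExponent hk ha0 hG hv0 hv1, neg_neg]
  exact gibbsExponent_le_max hk ha0 hc hu0 huv hvw hw1

/-! ### Mean counts of small weights -/

theorem one_add_pow_le_exp {x : ℝ} (hx : 0 ≤ x) (m : ℕ) : (1 + x) ^ m ≤ exp (m * x) := by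
  rw [exp_nat_mul]
  gcongr
  rw [add_comm]
  exact add_one_le_exp x

theorem meanWeight_mul_le {c d n l : ℕ} {B : ℝ} (hc : 0 < c) (hl : l ≤ n)
    (hB : (checkCount F d (c * n) (c * l) : ℝ) ≤ B) :
    meanWeight F c d n l * (n : ℝ) ^ (c * l) ≤ n.choose l * B * (l : ℝ) ^ (c * l) := by
  have ha1 := one_le_card_sub_one (F := F)
  have hcl : c * l ≤ c * n := Nat.mul_le_mul_left c hl
  have hch : (0 : ℝ) < (c * n).choose (c * l) := by exact_mod_cast Nat.choose_pos hcl
  have hch2 : (n : ℝ) ^ (c * l) ≤ (c * n).choose (c * l) * (l : ℝ) ^ (c * l) := by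
    have h : ((c * n : ℕ) : ℝ) ^ (c * l) ≤
        (c * n).choose (c * l) * ((c * l : ℕ) : ℝ) ^ (c * l) := by
      exact_mod_cast pow_le_choose_mul_pow hcl
    push_cast at h
    rw [mul_pow, mul_pow, mul_left_comm] at h
    exact le_of_mul_le_mul_left h (by positivity)
  have ha2 : ((Fintype.card F : ℝ) - 1) ^ l ≤ ((Fintype.card F : ℝ) - 1) ^ (c * l) :=
    pow_le_pow_right₀ ha1 (Nat.le_mul_of_pos_left l hc)
  have hB0 : 0 ≤ B := (Nat.cast_nonneg _).trans hB
  unfold meanWeight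
  rw [div_mul_eq_mul_div, div_le_iff₀ (by positivity)]
  calc _ ≤ (n.choose l : ℝ) * ((Fintype.card F : ℝ) - 1) ^ (c * l) * B *
        ((c * n).choose (c * l) * (l : ℝ) ^ (c * l)) := by gcongr
    _ = _ := by ring

theorem meanWeight_mul_pow_le {c d n l k : ℕ} (hc : 0 < c) (hcd : c ≤ d) (hdn : d ∣ c * n)
    (hn : 0 < n) (hl : l ≤ n) (hk : k + l + c * l / 2 ≤ c * l) :
    meanWeight F c d n l * (n : ℝ) ^ k ≤
      exp ((Fintype.card F : ℝ) ^ d) * (l : ℝ) ^ (c * l) := by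
  have hn' : (1 : ℝ) ≤ n := by exact_mod_cast hn
  have hn0 : (0 : ℝ) < n := by linarith
  have hmn : ((c * n / d : ℕ) : ℝ) ≤ n := by
    exact_mod_cast Nat.div_le_of_le_mul (Nat.mul_le_mul_right n hcd)
  have hB : (checkCount F d (c * n) (c * l) : ℝ) ≤
      exp ((Fintype.card F : ℝ) ^ d) * n ^ (c * l / 2) := by
    -- At `s = 1 / n` the product over at most `n` blocks stays bounded.
    have h1 := checkCount_mul_pow_half_le (F := F) (w := c * l) hdn (s := (n : ℝ)⁻¹)
      (by positivity) (inv_le_one_of_one_le₀ hn')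
    have h2 := one_add_pow_le_exp (x := (Fintype.card F : ℝ) ^ d * (n : ℝ)⁻¹) (by positivity)
      (c * n / d)
    have h3 : ((c * n / d : ℕ) : ℝ) * ((Fintype.card F : ℝ) ^ d * (n : ℝ)⁻¹) ≤
        (Fintype.card F : ℝ) ^ d := by
      calc _ ≤ (n : ℝ) * ((Fintype.card F : ℝ) ^ d * (n : ℝ)⁻¹) := by gcongr
        _ = _ := by field_simp
    have h4 := h1.trans (h2.trans (exp_le_exp.2 h3))
    rwa [inv_pow, ← div_eq_mul_inv, div_le_iff₀ (by positivity)] at h4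
  have h := meanWeight_mul_le hc hl hB
  have hch : (n.choose l : ℝ) ≤ (n : ℝ) ^ l := by exact_mod_cast Nat.choose_le_pow n l
  have h5 : (n : ℝ) ^ (k + l + c * l / 2) ≤ (n : ℝ) ^ (c * l) := pow_le_pow_right₀ hn' hk
  refine le_of_mul_le_mul_right ?_ (pow_pos hn0 (c * l))
  calc _ = meanWeight F c d n l * (n : ℝ) ^ (c * l) * (n : ℝ) ^ k := by ring
    _ ≤ n.choose l * (exp ((Fintype.card F : ℝ) ^ d) * n ^ (c * l / 2)) * (l : ℝ) ^ (c * l) *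
        (n : ℝ) ^ k := by gcongr
    _ ≤ (n : ℝ) ^ l * (exp ((Fintype.card F : ℝ) ^ d) * n ^ (c * l / 2)) * (l : ℝ) ^ (c * l) *
        (n : ℝ) ^ k := by gcongr
    _ = exp ((Fintype.card F : ℝ) ^ d) * (l : ℝ) ^ (c * l) * (n : ℝ) ^ (k + l + c * l / 2) := by
        rw [pow_add, pow_add]; ring
    _ ≤ _ := by gcongr

/-- The Chernoff parameter `√(l / n)` keeps the enumerator bounded by an `l`-th power and leaves a
factor `z ^ (c l)`. -/
theorem meanWeight_le_sqrt_pow {c d n l : ℕ} (hc : 3 ≤ c) (hcd : c ≤ d) (hdn : d ∣ c * n)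
    (h0 : 0 < l) (hl : l ≤ n) :
    meanWeight F c d n l ≤ (exp (1 + (Fintype.card F : ℝ) ^ d) * √(l / n)) ^ l := by
  have hl0 : (0 : ℝ) < l := by exact_mod_cast h0
  have hn0 : (0 : ℝ) < n := by exact_mod_cast h0.trans_le hl
  have hln : (l : ℝ) / n ≤ 1 := by rw [div_le_one hn0]; exact_mod_cast hl
  have hz0 : 0 < √((l : ℝ) / n) := sqrt_pos.2 (by positivity)
  have hz1 : √((l : ℝ) / n) ≤ 1 := sqrt_le_one.2 hln
  have hzsq : √((l : ℝ) / n) ^ 2 = l / n := sq_sqrt (by positivity)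
  generalize √((l : ℝ) / n) = z at *
  have hmn : ((c * n / d : ℕ) : ℝ) ≤ n := by
    exact_mod_cast Nat.div_le_of_le_mul (Nat.mul_le_mul_right n hcd)
  have hB : (checkCount F d (c * n) (c * l) : ℝ) ≤
      exp ((Fintype.card F : ℝ) ^ d) ^ l / z ^ (c * l) := by
    rw [le_div_iff₀ (by positivity)]
    refine (checkCount_le hdn hz0).trans ?_
    calc _ ≤ (1 + (Fintype.card F : ℝ) ^ d * z ^ 2) ^ (c * n / d) :=
          pow_le_pow_left₀ (zero_le_one.trans (one_le_weightEnum d hz0.le))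
            (weightEnum_le d hz0.le hz1) _
      _ ≤ exp ((c * n / d : ℕ) * ((Fintype.card F : ℝ) ^ d * z ^ 2)) :=
          one_add_pow_le_exp (by positivity) _
      _ ≤ exp (l * (Fintype.card F : ℝ) ^ d) := by
          refine exp_le_exp.2 ?_
          calc _ ≤ (n : ℝ) * ((Fintype.card F : ℝ) ^ d * z ^ 2) := by gcongr
            _ = _ := by rw [hzsq]; field_simp
      _ = _ := exp_nat_mul _ _
  have h := meanWeight_mul_le (by omega) hl hB
  have hch : (n.choose l : ℝ) * (l : ℝ) ^ l ≤ n ^ l * exp 1 ^ l := by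
    have h1 : (n.choose l : ℝ) ≤ n ^ l / l.factorial := Nat.choose_le_pow_div l n
    have h2 := pow_div_factorial_le_exp (l : ℝ) hl0.le l
    rw [← exp_nat_mul, mul_one]
    calc _ ≤ (n : ℝ) ^ l / l.factorial * (l : ℝ) ^ l := by gcongr
      _ = (n : ℝ) ^ l * ((l : ℝ) ^ l / l.factorial) := by ring
      _ ≤ _ := by gcongr
  have hlz : (l : ℝ) = n * z ^ 2 := by rw [hzsq]; field_simp
  have hch2 : (n.choose l : ℝ) * (z ^ 2) ^ l ≤ exp 1 ^ l := by
    have hch' : (n.choose l : ℝ) * (n * z ^ 2) ^ l ≤ n ^ l * exp 1 ^ l := by rwa [← hlz]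
    rw [mul_pow, mul_left_comm] at hch'
    exact le_of_mul_le_mul_left hch' (by positivity)
  have hmw : meanWeight F c d n l ≤ n.choose l * exp ((Fintype.card F : ℝ) ^ d) ^ l * z ^ (c * l) := by
    refine le_of_mul_le_mul_right (h.trans_eq ?_) (pow_pos hn0 (c * l))
    have : (l : ℝ) ^ (c * l) = (n : ℝ) ^ (c * l) * (z ^ (c * l) * z ^ (c * l)) := by
      conv_lhs => rw [hlz]
      rw [mul_pow, sq, mul_pow]
    rw [this]
    field_simp
  -- Of the `c = 3 + b` powers of `z ^ l`, two absorb the binomial coefficient, one gives the decay,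
  -- and the rest are at most 1.
  obtain ⟨b, rfl⟩ := Nat.exists_eq_add_of_le hc
  refine hmw.trans ?_
  calc _ = n.choose l * (z ^ 2) ^ l * exp ((Fintype.card F : ℝ) ^ d) ^ l * z ^ l * z ^ (b * l) := by
        ring
    _ ≤ exp 1 ^ l * exp ((Fintype.card F : ℝ) ^ d) ^ l * z ^ l * 1 := by
        gcongr
        exact pow_le_one₀ hz0.le hz1
    _ = _ := by rw [exp_add]; ring

end Bounds

/-! ### Summation over the weights -/

section Main

open Real

theorem bigTheta_const_mul {K : ℝ} (hK : 0 < K) (g : ℕ → ℝ) : BigTheta (fun n => K * g n) g :=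
  ⟨K, hK, K, hK, Eventually.of_forall fun _ => ⟨le_rfl, le_rfl⟩⟩

theorem pow_mul_exp_neg_le {η x : ℝ} (hη : 0 < η) (hx : 0 ≤ x) (m : ℕ) :
    x ^ m * exp (-(η * x)) ≤ m.factorial / η ^ m := by
  have h := pow_div_factorial_le_exp (η * x) (by positivity) m
  rw [exp_neg, ← div_eq_mul_inv, div_le_div_iff₀ (exp_pos _) (by positivity)]
  rw [div_le_iff₀ (by positivity), mul_pow] at h
  linarith

/-- The integer `c l - l - ⌊c l / 2⌋` is at least `(c - 2) l / 2`, hence at least the ceiling for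
any `l₁ ≤ l`. -/
theorem ceil_add_le {c l₁ l : ℕ} (hc : 2 ≤ c) (hl : l₁ ≤ l) :
    ⌈((c : ℝ) - 2) * l₁ / 2⌉.toNat + l + c * l / 2 ≤ c * l := by
  have h1 : ((c * l / 2 : ℕ) : ℝ) ≤ c * l / 2 := by
    have := Nat.cast_div_le (α := ℝ) (m := c * l) (n := 2)
    push_cast at this
    exact this
  have h2 : (l₁ : ℝ) ≤ l := by exact_mod_cast hl
  have h3 : (2 : ℝ) ≤ c := by exact_mod_cast hc
  have h5 : l + c * l / 2 ≤ c * l := by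
    have : 2 * l ≤ c * l := Nat.mul_le_mul_right l hc
    omega
  generalize c * l / 2 = j at *
  have h4 : ⌈((c : ℝ) - 2) * l₁ / 2⌉ ≤ (c * l : ℕ) - (l : ℕ) - (j : ℕ) := by
    rw [Int.ceil_le]
    push_cast
    nlinarith
  generalize ⌈((c : ℝ) - 2) * l₁ / 2⌉ = e at *
  generalize c * l = w at *
  omega

variable {F : Type*} [Field F] [Fintype F] [DecidableEq F]

/-- With `y = K √(l / n) ≤ 1/2`, the factor `y ^ (2κ)` pays for `n ^ κ` at the price `(K² l) ^ κ`;
the remaining powers decay geometrically. -/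
theorem meanWeight_mul_pow_le_geometric {c d n l κ : ℕ} {K : ℝ} (hc : 3 ≤ c) (hcd : c ≤ d)
    (hdn : d ∣ c * n) (h0 : 0 < l) (hl : l ≤ n) (hκ : 2 * κ ≤ l)
    (hK : K = exp (1 + (Fintype.card F : ℝ) ^ d)) (hlK : (l : ℝ) ≤ 1 / (4 * K ^ 2) * n) :
    meanWeight F c d n l * (n : ℝ) ^ κ ≤ (4 * K ^ 2) ^ κ * ((l : ℝ) ^ κ * (1 / 2) ^ l) := by
  have hK0 : 0 < K := hK ▸ exp_pos _
  have hn0 : (0 : ℝ) < n := by exact_mod_cast h0.trans_le hl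
  have h := meanWeight_le_sqrt_pow hc hcd hdn h0 hl (F := F)
  rw [← hK] at h
  have hy0 : 0 ≤ K * √((l : ℝ) / n) := by positivity
  have hysq : (K * √((l : ℝ) / n)) ^ 2 = K ^ 2 * (l / n) := by
    rw [mul_pow, sq_sqrt (by positivity)]
  generalize K * √((l : ℝ) / n) = y at *
  have hy1 : y ≤ 1 / 2 := by
    refine le_of_sq_le_sq ?_ (by norm_num)
    rw [hysq]
    have : (l : ℝ) / n ≤ 1 / (4 * K ^ 2) := by rwa [div_le_iff₀ hn0]
    calc K ^ 2 * ((l : ℝ) / n) ≤ K ^ 2 * (1 / (4 * K ^ 2)) := by gcongr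
      _ = (1 / 2) ^ 2 := by field_simp; norm_num
  obtain ⟨r, rfl⟩ := Nat.exists_eq_add_of_le hκ
  have hyn : y ^ 2 * n = K ^ 2 * ((2 * κ + r : ℕ) : ℝ) := by rw [hysq]; field_simp
  calc _ ≤ y ^ (2 * κ + r) * (n : ℝ) ^ κ := by gcongr
    _ = (y ^ 2 * n) ^ κ * y ^ r := by ring
    _ ≤ (y ^ 2 * n) ^ κ * (1 / 2) ^ r := by gcongr
    _ = _ := by
      rw [hyn, pow_add (1 / 2 : ℝ), pow_mul (1 / 2 : ℝ), mul_pow, mul_pow (4 : ℝ)]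
      have : (4 : ℝ) ^ κ * ((1 / 2 : ℝ) ^ 2) ^ κ = 1 := by rw [← mul_pow]; norm_num
      linear_combination (-((K ^ 2) ^ κ * ((2 * κ + r : ℕ) : ℝ) ^ κ * (1 / 2) ^ r)) * this

theorem exists_sum_meanWeight_mul_pow_le {q c d : ℕ} (hF : Fintype.card F = q) (hc : 3 ≤ c)
    (hcd : c ≤ d) {l₀ l₁ : ℕ} (hl₀ : 1 ≤ l₀) (hl₁ : ∀ l, l₀ ≤ l → l < l₁ → q = 2 ∧ Odd (c * l))
    {α : ℝ} (hα : α ∈ Set.Ioo (0 : ℝ) (1 - 1 / (q : ℝ))) (hω : omega q c d α < 0) :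
    ∃ M > 0, ∀ n : ℕ, 1 ≤ n → d ∣ c * n →
      (∑ l ∈ Finset.Icc l₀ ⌊n * α⌋₊, meanWeight F c d n l) *
        (n : ℝ) ^ ⌈((c : ℝ) - 2) * l₁ / 2⌉.toNat ≤ M := by
  set κ := ⌈((c : ℝ) - 2) * l₁ / 2⌉.toNat with hκ
  set H : ℝ := (Fintype.card F : ℝ) ^ d with hH
  obtain ⟨K, hK⟩ : ∃ K, K = exp (1 + H) := ⟨_, rfl⟩
  obtain ⟨a, ha⟩ : ∃ a, a = (Fintype.card F : ℝ) - 1 := ⟨_, rfl⟩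
  have hK0 : 0 < K := hK ▸ exp_pos _
  have ha1 : 1 ≤ a := ha ▸ one_le_card_sub_one
  have haq : a = (q : ℝ) - 1 := by rw [ha, hF]
  have hd : 0 < d := by omega
  obtain ⟨k, rfl⟩ : ∃ k, d = k + 1 := ⟨d - 1, by omega⟩
  have hk : k ≠ 0 := by omega
  have hα' : α < a / (a + 1) := by
    have hq : (q : ℝ) = a + 1 := by rw [haq]; ring
    have := hα.2
    have ha1' : a + 1 ≠ 0 := by positivity
    rw [hq] at this
    rwa [show a / (a + 1) = 1 - 1 / (a + 1) by field_simp; ring]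
  have hα1 : α < 1 := hα'.trans (by rw [div_lt_one (by linarith)]; linarith)
  -- The bound by `1 / (4 K²)` serves the geometric range, the exponential one makes the exponent at
  -- `ε` negative.
  obtain ⟨ε, hε0, hεα, hεK, hεH⟩ : ∃ ε > 0, ε < α ∧ ε ≤ 1 / (4 * K ^ 2) ∧ ε < exp (-(2 * c * H)) := by
    refine ⟨min (α / 2) (min (1 / (4 * K ^ 2)) (exp (-(2 * c * H)) / 2)), ?_, ?_, ?_, ?_⟩
    · have := hα.1
      positivity
    · exact (min_le_left _ _).trans_lt (half_lt_self hα.1)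
    · exact (min_le_right _ _).trans (min_le_left _ _)
    · exact ((min_le_right _ _).trans (min_le_right _ _)).trans_lt (half_lt_self (exp_pos _))
  obtain ⟨z', hz', hzα⟩ := exists_chernoffExponent_neg hF haq (by omega : 0 < c) hd hα.1 hα1 hω
  have hzε := chernoffExponent_sqrt_neg ha hc hd hε0 hεH
  push_cast at hzα hzε
  obtain ⟨η, hη, hexp⟩ := exists_chernoffExponent_le hk ha
    (by exact_mod_cast (by omega : 1 ≤ c) : (1 : ℝ) ≤ c) hε0 hεα hα' (sqrt_pos.2 hε0) hz' hzε hzα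
  have hsummable : Summable fun l : ℕ => (l : ℝ) ^ κ * (1 / 2 : ℝ) ^ l :=
    summable_pow_mul_geometric_of_norm_lt_one κ (by norm_num)
  -- One summand for each range with nonzero terms. In the last, the exponent `κ + 2` counts one `n`
  -- from the Chernoff prefactor and one from the number of weights.
  refine ⟨∑ l ∈ Finset.range (2 * κ), exp H * (l : ℝ) ^ (c * l) +
    (4 * K ^ 2) ^ κ * ∑' l : ℕ, (l : ℝ) ^ κ * (1 / 2 : ℝ) ^ l +
    (c + 1) * ((κ + 2).factorial / η ^ (κ + 2)), ?_, ?_⟩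
  · have h1 : 0 ≤ ∑' l : ℕ, (l : ℝ) ^ κ * (1 / 2 : ℝ) ^ l := tsum_nonneg fun l => by positivity
    have h2 : 0 ≤ ∑ l ∈ Finset.range (2 * κ), exp H * (l : ℝ) ^ (c * l) :=
      Finset.sum_nonneg fun l _ => by positivity
    positivity
  intro n hn hdn
  have hn' : (1 : ℝ) ≤ n := by exact_mod_cast hn
  have hfloor : ⌊n * α⌋₊ ≤ n := Nat.floor_le_of_le (by nlinarith)
  have hterm : ∀ l ∈ Finset.Icc l₀ ⌊n * α⌋₊, meanWeight F c (k + 1) n l * (n : ℝ) ^ κ ≤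
      (if l < 2 * κ then exp H * (l : ℝ) ^ (c * l) else 0) +
      (4 * K ^ 2) ^ κ * ((l : ℝ) ^ κ * (1 / 2 : ℝ) ^ l) +
      (c + 1) * (n : ℝ) ^ (κ + 1) * exp (-(η * n)) := by
    intro l hl
    obtain ⟨hl0, hlα⟩ := Finset.mem_Icc.1 hl
    have hpos1 : 0 ≤ (if l < 2 * κ then exp H * (l : ℝ) ^ (c * l) else 0) := by
      split_ifs <;> positivity
    have hpos2 : 0 ≤ (4 * K ^ 2) ^ κ * ((l : ℝ) ^ κ * (1 / 2 : ℝ) ^ l) := by positivity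
    have hpos3 : 0 ≤ (c + 1) * (n : ℝ) ^ (κ + 1) * exp (-(η * n)) := by positivity
    have hlpos : 0 < l := by omega
    have hln : l ≤ n := hlα.trans hfloor
    rcases lt_or_ge l l₁ with hlt | hge
    · obtain ⟨hq2, hodd⟩ := hl₁ l hl0 hlt
      have : meanWeight F c (k + 1) n l = 0 := by
        rw [meanWeight, checkCount_eq_zero hdn (hF.trans hq2) hodd]
        simp
      rw [this, zero_mul]
      positivity
    · rcases lt_or_ge l (2 * κ) with hlκ | hlκ
      · have := meanWeight_mul_pow_le (F := F) (by omega) hcd hdn hn hln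
          (ceil_add_le (by omega : 2 ≤ c) hge)
        rw [if_pos hlκ]
        linarith
      · rcases le_or_gt (l : ℝ) (ε * n) with hlε | hlε
        · have := meanWeight_mul_pow_le_geometric (F := F) hc hcd hdn hlpos hln hlκ hK
            (hlε.trans (by gcongr))
          linarith
        · have hlα' : (l : ℝ) ≤ n * α := 
            (Nat.cast_le.2 hlα).trans (Nat.floor_le (mul_nonneg (by linarith) hα.1.le))
          have hn0 : (0 : ℝ) < n := by linarith
          obtain ⟨y, hy, hye⟩ := hexp (l / n) (by rw [le_div_iff₀ hn0]; exact hlε.le)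
            (by rw [div_le_iff₀ hn0]; linarith)
          have hlt : l < n := by
            have : (l : ℝ) < n := by nlinarith
            exact_mod_cast this
          have hm := meanWeight_le_exp (F := F) ha (by omega : 0 < c) hd hdn hlpos hlt hy
          push_cast at hm
          have : meanWeight F c (k + 1) n l * (n : ℝ) ^ κ ≤
              (c + 1) * (n : ℝ) ^ (κ + 1) * exp (-(η * n)) := by
            calc _ ≤ (c * n + 1) * exp (n * chernoffExponent a c (k + 1)
                  (weightEnum F (k + 1)) (l / n) y) * (n : ℝ) ^ κ := by gcongr
              _ ≤ (c * n + n) * exp (n * -η) * (n : ℝ) ^ κ := by gcongr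
              _ = _ := by rw [pow_succ, show (n : ℝ) * -η = -(η * n) by ring]; ring
          linarith
  rw [Finset.sum_mul]
  refine (Finset.sum_le_sum hterm).trans ?_
  rw [Finset.sum_add_distrib, Finset.sum_add_distrib]
  refine add_le_add (add_le_add ?_ ?_) ?_
  · rw [← Finset.sum_filter]
    refine Finset.sum_le_sum_of_subset_of_nonneg (fun l hl => ?_) fun l _ _ => by positivity
    exact Finset.mem_range.2 (Finset.mem_filter.1 hl).2
  · rw [← Finset.mul_sum]
    gcongr
    exact hsummable.sum_le_tsum _ fun l _ => by positivity
  · rw [Finset.sum_const, nsmul_eq_mul, Nat.card_Icc]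
    -- At most `n` weights occur because `l₀ ≥ 1`.
    have hcard : ((⌊n * α⌋₊ + 1 - l₀ : ℕ) : ℝ) ≤ n := by
      exact_mod_cast (by omega : ⌊n * α⌋₊ + 1 - l₀ ≤ n)
    calc _ ≤ (n : ℝ) * ((c + 1) * (n : ℝ) ^ (κ + 1) * exp (-(η * n))) := by gcongr
      _ = (c + 1) * ((n : ℝ) ^ (κ + 2) * exp (-(η * n))) := by ring
      _ ≤ _ := by
        gcongr
        exact pow_mul_exp_neg_le hη (by linarith) _

end Main

end LDPC

theorem mainTheorem1 (q : ℕ) (F : Type*) [Field F] [Fintype F] [DecidableEq F]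
    (hF : Fintype.card F = q) (c d : ℕ) (hc : 3 ≤ c) (hcd : c ≤ d)
    (l₀ : ℕ) (hl₀ : 1 ≤ l₀) (α : ℝ) (hα : α ∈ Set.Ioo (0 : ℝ) (1 - 1 / (q : ℝ)))
    (Δ : ℕ) (hΔ : Δ = if q = 2 ∧ Odd (c * l₀) then 1 else 0) :
    ∃ A B : ℕ → ℝ,
      LDPC.BigTheta A
        (fun n => (n : ℝ) ^ (-⌈((c : ℝ) - 2) * ((l₀ : ℝ) + (Δ : ℝ)) / 2⌉ : ℤ)) ∧
      LDPC.BigTheta B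
        (fun n => (n : ℝ) ^ (3 / 2 : ℝ) * Real.exp ((n : ℝ) * LDPC.omega q c d α)) ∧
      ∀ n : ℕ, 1 ≤ n → d ∣ c * n →
        ((LDPC.randomCode F c d n).toOuterMeasure
          {C : Submodule F (Fin n → F) |
            ∃ m : ℕ, LDPC.minDist (C : Set (Fin n → F)) = (m : ℕ∞) ∧
              l₀ ≤ m ∧ (m : ℝ) ≤ n * α}).toReal ≤ A n + B n := by
  have hB := LDPC.bigTheta_const_mul one_pos
    fun n : ℕ => (n : ℝ) ^ (3 / 2 : ℝ) * Real.exp ((n : ℝ) * LDPC.omega q c d α)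
  -- For a nonnegative rate `B n ≥ 1`, so the trivial bound on a probability suffices.
  rcases le_or_gt 0 (LDPC.omega q c d α) with hω | hω
  · refine ⟨_, _, LDPC.bigTheta_const_mul one_pos _, hB, fun n hn _ => ?_⟩
    refine (LDPC.prob_le_one c d n _).trans ?_
    have hn' : (1 : ℝ) ≤ n := by exact_mod_cast hn
    have h1 : 1 ≤ (n : ℝ) ^ (3 / 2 : ℝ) := Real.one_le_rpow hn' (by norm_num)
    have h2 : 1 ≤ Real.exp ((n : ℝ) * LDPC.omega q c d α) := Real.one_le_exp (by positivity)
    have h3 : 0 ≤ (n : ℝ) ^ (-⌈((c : ℝ) - 2) * ((l₀ : ℝ) + (Δ : ℝ)) / 2⌉ : ℤ) := by positivity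
    have h4 := one_le_mul_of_one_le_of_one_le h1 h2
    linarith
  · have hl₁ : ∀ l, l₀ ≤ l → l < l₀ + Δ → q = 2 ∧ Odd (c * l) := by
      intro l h1 h2
      split_ifs at hΔ with h
      · rwa [show l = l₀ by omega]
      · omega
    obtain ⟨M, hM, hsum⟩ :=
      LDPC.exists_sum_meanWeight_mul_pow_le hF hc hcd hl₀ hl₁ hα hω
    refine ⟨_, _, LDPC.bigTheta_const_mul hM _, hB, fun n hn hdn => ?_⟩
    have hn0 : (0 : ℝ) < n := by exact_mod_cast hn
    have hα1 : α ≤ 1 := hα.2.le.trans (sub_le_self _ (by positivity))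
    refine (LDPC.prob_le_sum c d n l₀ hα1).trans ?_
    have h := hsum n hn hdn
    push_cast at h
    have hceil : 0 ≤ ⌈((c : ℝ) - 2) * ((l₀ : ℝ) + (Δ : ℝ)) / 2⌉ := by
      have : (3 : ℝ) ≤ c := by exact_mod_cast hc
      exact Int.ceil_nonneg (div_nonneg (mul_nonneg (by linarith) (by positivity)) zero_le_two)
    rw [← le_div_iff₀ (by positivity), ← zpow_natCast, Int.toNat_of_nonneg hceil,
      div_eq_mul_inv, ← zpow_neg] at h
    refine h.trans (le_add_of_nonneg_right ?_)
    positivity
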